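/- Let $V=\{1,\dots,n\}$, let $G_0=(V,E_0)$ be a deterministic graph without self-loops, $E_0\subset V\times V$ (an unoriented edge is identified with the two oriented edges in both directions), and let $E_{\rm open}$ be the random set that contains every oriented edge $i\to j\notin E_0$, $i\ne j$, independently with probability $p_{\rm open}=p_{\rm open}(n)$. For $t\ge 0$ let $$E_{t+1}=E_t\cup\{\,i\to j\in E_{\rm open}:\ i\to k\in E_t\text{ and }k\to j\in E_t\text{ for some }k\in V\,\},\qquad E_\infty=\bigcup_{t\ge0}E_t .$$ The length of an edge $i\to j$ is the number of edges of a shortest oriented path from $i$ to $j$ in $G_0$ ($\infty$ if there is none). An event (depending on $n$) holds a.a.s. if its probability tends to $1$ as $n\to\infty$. **Theorem.** Fix a constant $\alpha>0$ and an integer $D\ge0$. There exist constants $c,C\in(0,\infty)$, depending only on $D$ and $\alpha$, such that for all sequences of connected unoriented graphs $G_0$ with all degrees at most $D$: 1. if $p_{\rm open}<c/\sqrt{\log n}$ for all large $n$, then a.a.s. no edge of length exceeding $\alpha\log n$ belongs to $E_\infty$; 2. if $p_{\rm open}>C\log\log n/\sqrt{\log n}$ for all large $n$, then a.a.s. saturation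 occurs, i.e. $E_\infty=E_0\cup E_{\rm open}$. Moreover, the following stronger forms hold. - (Stronger form of 1.) For all $\alpha>0$ and $D$ there is $c=c(\alpha,D)>0$ such that, for all sequences of oriented graphs $G_0$, connected or not, with all in-degrees and out-degrees at most $D$, if $p_{\rm open}<c/\sqrt{\log n}$ for all large $n$, then $$\mathbb P(\text{some edge of length at least }\alpha\log n\text{ belongs to }E_\infty)\to0\quad\text{as }n\to\infty .$$ - (Stronger form of 2.) For every $C>4$ and all sequences of connected unoriented graphs $G_0$ (with no bound on the degrees), if $p_{\rm open}\ge C\log\log n/\sqrt{\log n}$ for all large $n$, then a.a.s. $E_\infty=E_0\cup E_{\rm open}$. -/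

import Mathlib

open MeasureTheory ProbabilityTheory Filter Topology
open scoped ENNReal unitInterval

namespace TransClosure

/-- The edge set of an unoriented graph: an unoriented edge is identified with the two
oriented edges `(i, j)` and `(j, i)`. -/
def edges {V : Type*} (G : SimpleGraph V) : Set (V × V) :=
  {e | G.Adj e.1 e.2}

/-- The occupied edges `E_t` at time `t`, started from `E0`: an open edge `(i, j)` becomes
occupied at time `t + 1` if `(i, k)` and `(k, j)` are occupied at time `t` for some `k`. -/
def occupied {V : Type*} (E0 Eopen : Set (V × V)) : ℕ → Set (V × V)
  | 0 => E0
  | t + 1 => occupied E0 Eopen t ∪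
      {e | e ∈ Eopen ∧ ∃ k, (e.1, k) ∈ occupied E0 Eopen t ∧ (k, e.2) ∈ occupied E0 Eopen t}

/-- The eventually occupied edges `E_∞ = ⋃ t, E_t`. -/
def eventuallyOccupied {V : Type*} (E0 Eopen : Set (V × V)) : Set (V × V) :=
  ⋃ t, occupied E0 Eopen t

/-- There is an oriented walk with exactly `m` edges, all in `E0`, from `i` to `j`. -/
def WalkIn {V : Type*} (E0 : Set (V × V)) : ℕ → V → V → Prop
  | 0, i, j => i = j
  | m + 1, i, j => ∃ k, (i, k) ∈ E0 ∧ WalkIn E0 m k j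

/-- The length of an edge `(i, j)`: the number of edges of a shortest oriented path from `i` to
`j` in the initial graph (`⊤` if there is none). A shortest walk is automatically a path. -/
noncomputable def length {V : Type*} (E0 : Set (V × V)) (e : V × V) : ℕ∞ :=
  ⨅ (m : ℕ) (_ : WalkIn E0 m e.1 e.2), (m : ℕ∞)

/-- The law of the set of open edges of the oriented Erdős–Rényi graph of density `p`: every
oriented edge that is neither initially occupied nor a self-loop is open with probability `p`,
independently of the others; the remaining ones are never open. -/
noncomputable def openLaw {V : Type*} (E0 : Set (V × V)) (p : I) : Measure (Set (V × V)) :=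
  setBernoulli {e | e.1 ≠ e.2 ∧ e ∉ E0} p

/-- Probability of saturation, `E_∞ = E_0 ∪ E_open`. -/
noncomputable def probSaturated {V : Type*} (E0 : Set (V × V)) (p : I) : ℝ≥0∞ :=
  openLaw E0 p {Eopen | eventuallyOccupied E0 Eopen = E0 ∪ Eopen}

end TransClosure

/-! Below the threshold, an occupied edge is the root of a binary tree of applications of the rule
whose leaves are initial edges. The vertices of the tree form a connected set of the initial graph,
and there are at least as many of them as the length of the edge. The size of a tree is at most the
sum of the sizes of its two subtrees, so some subtree has between `L` and `2 * L` vertices, where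
`L` is about `α * log n` (`Spans.exists_card_le`). In that subtree every leaf has a sibling, and the
open edge that the two produce closes a triangle over the leaf (`Spans.exists_reinforced`). A
matching among the leaves gives order `L` such triangles on distinct open edges, each available with
probability at most `D * p + 2 * L * p ^ 2`, which is as small as desired when `p < c / √(log n)`.
There are only `n * exp (O(L))` choices of the connected set and the matching, so the union bound
`openLaw_real_long_le` tends to `0`.

Above the threshold, the open edges contain two independent sets, of densities `p₁` and `q`. The
first set provides a nucleus. A connected set of `k + 1` vertices becomes saturated as soon as one
of its vertices is joined to all the others by open edges in both directions
(`saturatedOn_of_open_star`), and a bounded-degree graph has so many disjoint candidates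
(`exists_disjoint_preconnected`) that one of them succeeds. If some degree exceeds `k`, a star is
already present. The second set makes the nucleus grow along the initial edges. A saturated set `S`
absorbs an adjacent vertex `v` when the neighbours of `v` in `S` are well connected among themselves
(`Expands`, `SaturatedOn.insert`). For `S` with `t + 1` vertices there are about `q * t` such
neighbours, and they fail to be well connected with probability about `exp (-c * q ^ 2 * t)` up to
polynomial factors (`setBernoulli_univ_real_not_expands_le`). This is summable over `t ≥ k` with
small sum once `q ^ 2 * k` is a large enough multiple of `log log n`. -/

namespace TransClosure

/-! ### Random subsets of a finite set -/

section Bernoulli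

variable {ι : Type*}

-- Membership of `i` is a coordinate with values in `Prop`, of law `p • dirac (i ∈ u) + (1 - p) •
-- dirac False`. Taking `f i` to be `{True}` or `{False}` then prescribes inclusion or avoidance.
open Classical in
lemma setBernoulli_real_pi (u : Set ι) (p : I) (s : Finset ι) (f : ι → Set Prop) :
    (setBernoulli u p).real {ω | ∀ i ∈ s, (i ∈ ω) ∈ f i} =
      ∏ i ∈ s, ((if (i ∈ u) ∈ f i then (p : ℝ) else 0) +
        (if False ∈ f i then (1 - p : ℝ) else 0)) := by
  rw [measureReal_def, setBernoulli_apply']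
  have h : (fun p : ι → Prop ↦ {i | p i}) ⁻¹' {ω : Set ι | ∀ i ∈ s, (i ∈ ω) ∈ f i} =
      (s : Set ι).pi f := by
    ext; simp [Set.mem_pi]
  rw [h, Measure.infinitePi_pi _ (fun i _ => MeasurableSet.of_discrete), ENNReal.toReal_prod]
  refine Finset.prod_congr rfl fun i _ => ?_
  rw [Measure.add_apply, Measure.smul_apply, Measure.smul_apply, Measure.dirac_apply,
    Measure.dirac_apply]
  by_cases h1 : (i ∈ u) ∈ f i <;> by_cases h2 : False ∈ f i
  · simp only [Set.indicator_of_mem h1, Set.indicator_of_mem h2, if_pos h1, if_pos h2]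
    simp [ENNReal.smul_def, ENNReal.toReal_add]
  · simp only [Set.indicator_of_mem h1, Set.indicator_of_notMem h2, if_pos h1, if_neg h2]
    simp [ENNReal.smul_def]
  · simp only [Set.indicator_of_notMem h1, Set.indicator_of_mem h2, if_neg h1, if_pos h2]
    simp [ENNReal.smul_def]
  · simp only [Set.indicator_of_notMem h1, Set.indicator_of_notMem h2, if_neg h1, if_neg h2]
    simp

lemma setBernoulli_real_avoid [DecidableEq ι] (u : Set ι) [DecidablePred (· ∈ u)] (p : I)
    (U : Finset ι) :
    (setBernoulli u p).real {ω | ∀ i ∈ U, i ∉ ω} = (1 - p : ℝ) ^ (U.filter (· ∈ u)).card := by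
  classical
  have h := setBernoulli_real_pi u p U (fun _ => {False})
  have h2 : {ω : Set ι | ∀ i ∈ U, (i ∈ ω) ∈ ({False} : Set Prop)} =
      {ω : Set ι | ∀ i ∈ U, i ∉ ω} := by
    ext; simp
  rw [h2] at h
  rw [h, Finset.card_filter, ← Finset.prod_pow_eq_pow_sum]
  refine Finset.prod_congr rfl fun i _ => ?_
  by_cases hi : i ∈ u <;> simp [hi]

lemma setBernoulli_real_subset_le (u : Set ι) (p : I) (T : Finset ι) :
    (setBernoulli u p).real {ω | ∀ i ∈ T, i ∈ ω} ≤ (p : ℝ) ^ T.card := by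
  classical
  have h := setBernoulli_real_pi u p T (fun _ => {True})
  have h2 : {ω : Set ι | ∀ i ∈ T, (i ∈ ω) ∈ ({True} : Set Prop)} =
      {ω : Set ι | ∀ i ∈ T, i ∈ ω} := by
    ext; simp
  rw [h2] at h
  rw [h]
  rw [← Finset.prod_const]
  refine Finset.prod_le_prod (fun i _ => ?_) fun i _ => ?_ <;>
    by_cases hi : i ∈ u <;> simp [hi, p.2.1]

lemma setBernoulli_univ_real_cylinder [DecidableEq ι] (p : I) {T U : Finset ι}
    (hTU : Disjoint T U) :
    (setBernoulli (Set.univ : Set ι) p).real {ω | (∀ i ∈ T, i ∈ ω) ∧ ∀ i ∈ U, i ∉ ω} =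
      (p : ℝ) ^ T.card * (1 - p : ℝ) ^ U.card := by
  classical
  have h := setBernoulli_real_pi Set.univ p (T ∪ U) (fun i => if i ∈ T then {True} else {False})
  have h2 : {ω : Set ι | ∀ i ∈ T ∪ U, (i ∈ ω) ∈ (if i ∈ T then {True} else {False} : Set Prop)} =
      {ω : Set ι | (∀ i ∈ T, i ∈ ω) ∧ ∀ i ∈ U, i ∉ ω} := by
    ext ω
    simp only [Finset.mem_union, Set.mem_ofPred_eq]
    constructor
    · intro H
      refine ⟨fun i hi => ?_, fun i hi => ?_⟩
      · simpa [hi] using H i (Or.inl hi)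
      · have : i ∉ T := fun h => Finset.disjoint_left.1 hTU h hi
        simpa [this] using H i (Or.inr hi)
    · rintro ⟨H1, H2⟩ i hi
      by_cases hT : i ∈ T
      · simpa [hT] using H1 i hT
      · simpa [hT] using H2 i (hi.resolve_left hT)
  rw [h2] at h
  rw [h, Finset.prod_union hTU, ← Finset.prod_const, ← Finset.prod_const]
  congr 1
  · refine Finset.prod_congr rfl fun i hi => ?_
    simp [hi]
  · refine Finset.prod_congr rfl fun i hi => ?_
    have : i ∉ T := fun h => Finset.disjoint_left.1 hTU h hi
    simp [this]

lemma setBernoulli_univ_real_subset (p : I) (T : Finset ι) :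
    (setBernoulli (Set.univ : Set ι) p).real {ω | ∀ i ∈ T, i ∈ ω} = (p : ℝ) ^ T.card := by
  classical
  simpa using setBernoulli_univ_real_cylinder p (Finset.disjoint_empty_right T)

/-- Among events asking for disjoint finite sets to be included in a random set, the probability
that none occurs is the product of the individual probabilities. -/
lemma setBernoulli_univ_real_none [Finite ι] {J : Type*} [Fintype J] (p : I)
    (T : J → Finset ι) (hT : Pairwise fun i j => Disjoint (T i) (T j)) :
    (setBernoulli (Set.univ : Set ι) p).real {ω | ∀ j, ¬ ∀ i ∈ T j, i ∈ ω} =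
      ∏ j, (1 - (p : ℝ) ^ (T j).card) := by
  classical
  set μ := setBernoulli (Set.univ : Set ι) p
  have hmeas : ∀ s : Set (Set ι), MeasurableSet s := fun s => MeasurableSet.of_discrete
  have hind : iIndepSet (fun j => {ω : Set ι | ∀ i ∈ T j, i ∈ ω}) μ := by
    rw [iIndepSet_iff_meas_biInter (fun _ => hmeas _)]
    intro s
    have h1 : (⋂ j ∈ s, {ω : Set ι | ∀ i ∈ T j, i ∈ ω}) =
        {ω | ∀ i ∈ s.biUnion T, i ∈ ω} := by
      ext ω
      simp only [Set.mem_iInter, Set.mem_ofPred_eq, Finset.mem_biUnion]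
      grind
    rw [h1, ← ENNReal.toReal_eq_toReal_iff' (by simp) (by simp [ENNReal.prod_ne_top]),
      ENNReal.toReal_prod, ← measureReal_def, setBernoulli_univ_real_subset,
      Finset.card_biUnion (fun i _ j _ hij => hT hij), ← Finset.prod_pow_eq_pow_sum]
    refine Finset.prod_congr rfl fun j _ => ?_
    rw [← measureReal_def, setBernoulli_univ_real_subset]
  have h2 := ((iIndepSet_iff_iIndep _ _).1 hind).meas_iInter
    (s := fun j => {ω : Set ι | ∀ i ∈ T j, i ∈ ω}ᶜ)
    (fun j => (MeasurableSpace.measurableSet_generateFrom (by simp)).compl)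
  have h3 : {ω : Set ι | ∀ j, ¬ ∀ i ∈ T j, i ∈ ω} =
      ⋂ j, {ω : Set ι | ∀ i ∈ T j, i ∈ ω}ᶜ := by
    ext; simp
  rw [h3, measureReal_def, h2, ENNReal.toReal_prod]
  refine Finset.prod_congr rfl fun j _ => ?_
  rw [← measureReal_def, probReal_compl_eq_one_sub (hmeas _), setBernoulli_univ_real_subset]

/-- Two measures on the subsets of a finite set agree if they give the same mass to each event
that the random set avoids a given set. -/
lemma measure_set_ext_avoid [Finite ι] {μ ν : Measure (Set ι)} [IsProbabilityMeasure μ]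
    [IsProbabilityMeasure ν]
    (h : ∀ U : Finset ι, μ {ω | ∀ i ∈ U, i ∉ ω} = ν {ω | ∀ i ∈ U, i ∉ ω}) : μ = ν := by
  classical
  have := Fintype.ofFinite ι
  refine ext_of_generate_finite (Set.range fun U : Finset ι => {ω : Set ι | ∀ i ∈ U, i ∉ ω})
    ?_ ?_ ?_ (by simp)
  · refine le_antisymm ?_ (MeasurableSpace.generateFrom_le fun s _ => MeasurableSet.of_discrete)
    intro s _
    have hs : s = ⋃ ω ∈ s, {ω} := by simp
    rw [hs]
    refine MeasurableSet.biUnion (Set.to_countable s) fun ω _ => ?_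
    -- Avoidance events are stable under intersection, and a point is recovered from them by
    -- differences: avoid the complement of `ω`, but no point of `ω`.
    have hω : ({ω} : Set (Set ι)) = {η | ∀ i ∈ (Finset.univ.filter (· ∉ ω)), i ∉ η} \
        ⋃ j ∈ ω, {η | ∀ i ∈ ({j} : Finset ι), i ∉ η} := by
      ext η
      simp only [Set.mem_singleton_iff, Finset.mem_filter, Finset.mem_univ, true_and, Set.mem_sdiff,
        Set.mem_ofPred_eq, Set.mem_iUnion, Finset.mem_singleton, exists_prop, not_exists, not_and]
      constructor
      · rintro rfl
        simp
      · rintro ⟨h1, h2⟩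
        ext i
        constructor
        · intro hi
          by_contra hc
          exact h1 i hc hi
        · intro hi
          by_contra hc
          exact h2 i hi (by simpa using hc)
    rw [hω]
    refine MeasurableSet.diff (MeasurableSpace.measurableSet_generateFrom ⟨_, rfl⟩) ?_
    exact MeasurableSet.biUnion (Set.to_countable _) fun j _ =>
      MeasurableSpace.measurableSet_generateFrom ⟨_, rfl⟩
  · rintro _ ⟨U, rfl⟩ _ ⟨W, rfl⟩ _
    refine ⟨U ∪ W, ?_⟩
    ext ω
    simp only [Finset.mem_union, Set.mem_ofPred_eq, Set.mem_inter_iff]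
    grind
  · rintro _ ⟨U, rfl⟩
    exact h U

/-- A Bernoulli random set is the union of two independent sparser ones. -/
lemma setBernoulli_eq_map_union [Finite ι] (u : Set ι) {p p₁ p₂ : I}
    (h : (1 - p : ℝ) = (1 - p₁) * (1 - p₂)) :
    setBernoulli u p = ((setBernoulli (Set.univ : Set ι) p₁).prod
      (setBernoulli (Set.univ : Set ι) p₂)).map (fun ω => (ω.1 ∪ ω.2) ∩ u) := by
  classical
  have hm : Measurable (fun ω : Set ι × Set ι => (ω.1 ∪ ω.2) ∩ u) := measurable_of_countable _
  have : IsProbabilityMeasure (((setBernoulli (Set.univ : Set ι) p₁).prod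
      (setBernoulli (Set.univ : Set ι) p₂)).map (fun ω => (ω.1 ∪ ω.2) ∩ u)) :=
    Measure.isProbabilityMeasure_map hm.aemeasurable
  refine measure_set_ext_avoid fun U => ?_
  rw [Measure.map_apply hm MeasurableSet.of_discrete]
  have hpre : (fun ω : Set ι × Set ι => (ω.1 ∪ ω.2) ∩ u) ⁻¹' {ω | ∀ i ∈ U, i ∉ ω} =
      {ω | ∀ i ∈ U.filter (· ∈ u), i ∉ ω} ×ˢ {ω | ∀ i ∈ U.filter (· ∈ u), i ∉ ω} := by
    ext ω
    simp only [Set.mem_preimage, Set.mem_ofPred_eq, Set.mem_prod, Finset.mem_filter, Set.mem_inter_iff,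
      Set.mem_union]
    grind
  rw [hpre, Measure.prod_prod,
    ← ENNReal.toReal_eq_toReal_iff' (by simp) (by simp [ENNReal.mul_eq_top]), ENNReal.toReal_mul,
    ← measureReal_def, ← measureReal_def, ← measureReal_def, setBernoulli_real_avoid,
    setBernoulli_real_avoid, setBernoulli_real_avoid, h, mul_pow]
  simp

end Bernoulli

/-! ### Connected sets of vertices -/

section Connected

variable {V : Type*}

lemma exists_boundary_adj {G : SimpleGraph V} {T A : Set V} (hT : (G.induce T).Preconnected)
    {a b : V} (ha : a ∈ T) (haA : a ∈ A) (hb : b ∈ T) (hbA : b ∉ A) :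
    ∃ x ∈ A, ∃ y ∈ T, y ∉ A ∧ G.Adj x y := by
  obtain ⟨q⟩ := hT ⟨a, ha⟩ ⟨b, hb⟩
  obtain ⟨d, _, h1, h2⟩ := q.exists_boundary_dart (Subtype.val ⁻¹' A) haA hbA
  exact ⟨d.fst, h1, d.snd, d.snd.2, h2, d.adj⟩

/-- A connected set of vertices includes the support of a closed walk, of any smaller size, which
is at most twice as long as its support is large. -/
lemma exists_walk_card_support [DecidableEq V] {G : SimpleGraph V} {T : Finset V} {v : V}
    (hv : v ∈ T) (hT : (G.induce (T : Set V)).Preconnected) {k : ℕ} (hk : k + 1 ≤ T.card) :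
    ∃ q : G.Walk v v, q.support.toFinset ⊆ T ∧ q.support.toFinset.card = k + 1 ∧
      q.length = 2 * k := by
  induction k with
  | zero => exact ⟨.nil, by simpa using hv, by simp, by simp⟩
  | succ k ih =>
    obtain ⟨q, hq1, hq2, hq3⟩ := ih (by omega)
    obtain ⟨b, hb, hbq⟩ := Finset.exists_of_ssubset
      (Finset.ssubset_iff_subset_ne.2 ⟨hq1, fun h => by rw [h] at hq2; omega⟩)
    obtain ⟨x, hx, y, hy, hyA, hxy⟩ := exists_boundary_adj (A := (q.support.toFinset : Set V)) hT
      hv (by simp) hb (by simpa using hbq)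
    have hxs : x ∈ q.support := by simpa using hx
    -- A detour from `x` to the new vertex `y` and back costs two steps.
    refine ⟨(q.takeUntil x hxs).append (.cons hxy (.cons hxy.symm (q.dropUntil x hxs))), ?_⟩
    have hsupp : ((q.takeUntil x hxs).append (.cons hxy (.cons hxy.symm
        (q.dropUntil x hxs)))).support.toFinset = insert y q.support.toFinset := by
      ext z
      have h1 : z ∈ q.support ↔ z ∈ (q.takeUntil x hxs).support ∨
          z ∈ (q.dropUntil x hxs).support := by
        rw [← SimpleGraph.Walk.mem_support_append_iff, q.take_spec hxs]
      simp only [List.mem_toFinset, SimpleGraph.Walk.mem_support_append_iff,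
        SimpleGraph.Walk.support_cons, List.mem_cons, Finset.mem_insert, h1]
      have : z = x → z ∈ (q.takeUntil x hxs).support := by rintro rfl; simp
      tauto
    have hlen : (q.takeUntil x hxs).length + (q.dropUntil x hxs).length = q.length := by
      rw [← SimpleGraph.Walk.length_append, q.take_spec hxs]
    refine ⟨?_, ?_, ?_⟩
    · rw [hsupp]
      exact Finset.insert_subset (by simpa using hy) hq1
    · rw [hsupp, Finset.card_insert_of_notMem (by simpa using hyA), hq2]
    · simp only [SimpleGraph.Walk.length_append, SimpleGraph.Walk.length_cons]
      omega

/-- A connected set of vertices is the support of a closed walk which is at most twice as long as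
the set is large. -/
lemma exists_covering_walk [DecidableEq V] {G : SimpleGraph V} {T : Finset V} {v : V} (hv : v ∈ T)
    (hT : (G.induce (T : Set V)).Preconnected) :
    ∃ q : G.Walk v v, q.support.toFinset = T ∧ q.length + 2 = 2 * T.card := by
  have hpos : 0 < T.card := Finset.card_pos.2 ⟨v, hv⟩
  obtain ⟨q, h1, h2, h3⟩ := exists_walk_card_support hv hT (k := T.card - 1) (by omega)
  exact ⟨q, Finset.eq_of_subset_of_card_le h1 (by omega), by omega⟩

variable [Fintype V]

open Classical in
/-- The sets of vertices visited by the walks from a given vertex, of a given number of steps each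
of which may be lazy. -/
noncomputable def walkSupports (G : SimpleGraph V) : ℕ → V → Finset (Finset V)
  | 0, v => {{v}}
  | m + 1, v => (insert v (G.neighborFinset v)).biUnion
      fun w => (walkSupports G m w).image (insert v)

lemma card_insert_neighborFinset_le [DecidableEq V] (G : SimpleGraph V) [DecidableRel G.Adj] {Δ : ℕ}
    {v : V} (hv : (G.neighborSet v).ncard ≤ Δ) : (insert v (G.neighborFinset v)).card ≤ Δ + 1 := by
  refine (Finset.card_insert_le _ _).trans (Nat.succ_le_succ ?_)
  rwa [← Set.ncard_coe_finset, SimpleGraph.coe_neighborFinset]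

lemma card_walkSupports_le {G : SimpleGraph V} {Δ : ℕ} (hG : ∀ v, (G.neighborSet v).ncard ≤ Δ)
    (m : ℕ) (v : V) : (walkSupports G m v).card ≤ (Δ + 1) ^ m := by
  classical
  induction m generalizing v with
  | zero => simp [walkSupports]
  | succ m ih =>
    rw [walkSupports, pow_succ']
    refine (Finset.card_biUnion_le_card_mul _ _ ((Δ + 1) ^ m) fun w _ =>
      Finset.card_image_le.trans (ih w)).trans ?_
    exact Nat.mul_le_mul_right _ (card_insert_neighborFinset_le G (hG v))

lemma mem_of_mem_walkSupports {G : SimpleGraph V} {m : ℕ} {v : V} {S : Finset V}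
    (h : S ∈ walkSupports G m v) : v ∈ S := by
  classical
  cases m with
  | zero => simp_all [walkSupports]
  | succ m =>
    rw [walkSupports, Finset.mem_biUnion] at h
    obtain ⟨w, _, h⟩ := h
    obtain ⟨S', _, rfl⟩ := Finset.mem_image.1 h
    simp

lemma walkSupports_mono {G : SimpleGraph V} {m m' : ℕ} (hm : m ≤ m') (v : V) :
    walkSupports G m v ⊆ walkSupports G m' v := by
  classical
  induction m', hm using Nat.le_induction with
  | base => exact Finset.Subset.refl _
  | succ m' _ ih =>
    intro S hS
    rw [walkSupports, Finset.mem_biUnion]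
    refine ⟨v, by simp, Finset.mem_image.2 ⟨S, ih hS, ?_⟩⟩
    exact Finset.insert_eq_of_mem (mem_of_mem_walkSupports hS)

lemma support_mem_walkSupports {G : SimpleGraph V} {u v : V} (q : G.Walk u v) {T : Finset V}
    (hT : ∀ z, z ∈ T ↔ z ∈ q.support) : T ∈ walkSupports G q.length u := by
  classical
  induction q generalizing T with
  | nil =>
    rw [SimpleGraph.Walk.length_nil, walkSupports, Finset.mem_singleton]
    ext z; simp [hT]
  | @cons u w v h q ih =>
    rw [SimpleGraph.Walk.length_cons, walkSupports, Finset.mem_biUnion]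
    refine ⟨w, ?_, Finset.mem_image.2 ⟨q.support.toFinset, ih fun z => List.mem_toFinset, ?_⟩⟩
    · rw [Finset.mem_insert, SimpleGraph.mem_neighborFinset]
      exact Or.inr h
    · ext z
      simp [hT]

/-- With `card_walkSupports_le` this bounds the number of connected sets through `v` exponentially
in their size; lazy steps bring all sizes up to a bound under one walk length. -/
lemma mem_walkSupports_of_preconnected {G : SimpleGraph V} {T : Finset V} {v : V} (hv : v ∈ T)
    (hT : (G.induce (T : Set V)).Preconnected) {m : ℕ} (hm : 2 * T.card ≤ m) :
    T ∈ walkSupports G m v := by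
  classical
  obtain ⟨q, hq, h⟩ := exists_covering_walk hv hT
  exact walkSupports_mono (by omega) v (support_mem_walkSupports q fun z => by simp [← hq])

end Connected

/-! ### Witness trees of occupied edges -/

section Witness

variable {V : Type*} {E0 Eopen : Set (V × V)}

lemma length_le_of_walkIn {m : ℕ} {i j : V} (h : WalkIn E0 m i j) : length E0 (i, j) ≤ m :=
  iInf₂_le m h

lemma WalkIn.concat {m : ℕ} {i j k : V} (h : WalkIn E0 m i j) (hk : (j, k) ∈ E0) :
    WalkIn E0 (m + 1) i k := by
  induction m generalizing i with
  | zero => obtain rfl : i = j := h; exact ⟨k, hk, rfl⟩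
  | succ m ih =>
    obtain ⟨l, hl, h⟩ := h
    exact ⟨l, hl, ih h⟩

lemma length_self (i : V) : length E0 (i, i) = 0 :=
  le_antisymm (by simpa using length_le_of_walkIn (E0 := E0) (m := 0) (i := i) (j := i) rfl) zero_le

lemma length_le_length_add_one {i j k : V} (h : (j, k) ∈ E0) :
    length E0 (i, k) ≤ length E0 (i, j) + 1 := by
  by_cases hj : ∃ m, WalkIn E0 m i j
  · have : length E0 (i, j) + 1 = ⨅ (m : ℕ) (_ : WalkIn E0 m i j), ((m : ℕ∞) + 1) := by
      rw [length, iInf_subtype', iInf_subtype', ENat.iInf_add]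
    rw [this]
    refine le_iInf₂ fun m hm => ?_
    exact_mod_cast length_le_of_walkIn (hm.concat h)
  · have : length E0 (i, j) = ⊤ := by
      push Not at hj
      simp [length, hj]
    simp [this]

/-- `Spans E0 Eopen T i j` says that the edge `(i, j)` becomes occupied by a tree of successive
applications of the rule in which all vertices involved are those of `T`. -/
inductive Spans [DecidableEq V] (E0 Eopen : Set (V × V)) : Finset V → V → V → Prop
  | edge {i j : V} (h : (i, j) ∈ E0) : Spans E0 Eopen {i, j} i j
  | step {T₁ T₂ : Finset V} {i k j : V} (h₁ : Spans E0 Eopen T₁ i k) (h₂ : Spans E0 Eopen T₂ k j)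
      (h : (i, j) ∈ Eopen) : Spans E0 Eopen (T₁ ∪ T₂) i j

/-- For the edge `e = (w, v)`, there is `x ∈ T` with `(x, v)` open and `(x, w)` initial or open. -/
def ReinforcedIn (E0 Eopen : Set (V × V)) (T : Finset V) (e : V × V) : Prop :=
  ∃ x ∈ T, (x, e.2) ∈ Eopen ∧ (x, e.1) ∈ E0 ∪ Eopen

/-- For the edge `e = (w, v)`, there is `y ∈ T` with `(w, y)` open and `(v, y)` initial or open. -/
def ReinforcedOut (E0 Eopen : Set (V × V)) (T : Finset V) (e : V × V) : Prop :=
  ∃ y ∈ T, (e.1, y) ∈ Eopen ∧ (e.2, y) ∈ E0 ∪ Eopen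

/-- An initial edge in `T` is reinforced if a vertex of `T` makes a usable triangle with it. -/
def Reinforced (E0 Eopen : Set (V × V)) (T : Finset V) (e : V × V) : Prop :=
  e ∈ E0 ∧ e.1 ∈ T ∧ e.2 ∈ T ∧ (ReinforcedIn E0 Eopen T e ∨ ReinforcedOut E0 Eopen T e)

lemma Reinforced.mono {T T' : Finset V} (hT : T ⊆ T') {e : V × V}
    (h : Reinforced E0 Eopen T e) : Reinforced E0 Eopen T' e := by
  obtain ⟨h0, h1, h2, ⟨x, hx, h⟩ | ⟨x, hx, h⟩⟩ := h
  · exact ⟨h0, hT h1, hT h2, Or.inl ⟨x, hT hx, h⟩⟩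
  · exact ⟨h0, hT h1, hT h2, Or.inr ⟨x, hT hx, h⟩⟩

variable [DecidableEq V]

lemma exists_spans {e : V × V} (h : e ∈ eventuallyOccupied E0 Eopen) :
    ∃ T, Spans E0 Eopen T e.1 e.2 := by
  obtain ⟨t, ht⟩ := Set.mem_iUnion.1 h
  clear h
  induction t generalizing e with
  | zero => exact ⟨_, .edge ht⟩
  | succ t ih =>
    rcases ht with ht | ⟨ho, k, h1, h2⟩
    · exact ih ht
    · obtain ⟨T1, hT1⟩ := ih h1
      obtain ⟨T2, hT2⟩ := ih h2
      exact ⟨_, .step hT1 hT2 ho⟩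

namespace Spans

variable {T : Finset V} {i j : V}

lemma mem_edges (h : Spans E0 Eopen T i j) : (i, j) ∈ E0 ∪ Eopen := by
  cases h with
  | edge h => exact Or.inl h
  | step _ _ h => exact Or.inr h

lemma mem_ends (h : Spans E0 Eopen T i j) : i ∈ T ∧ j ∈ T := by
  induction h with
  | edge h => simp
  | step _ _ _ h1 h2 => simp [h1, h2]

/-- A discrete intermediate value theorem: the leaves of the tree form a walk of initial edges from
`i` to `j`, along which the distance from `o` never rises by more than one. -/
lemma exists_length_eq (h : Spans E0 Eopen T i j) {o : V} {t : ℕ∞} (h1 : length E0 (o, i) ≤ t)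
    (h2 : t ≤ length E0 (o, j)) : ∃ x ∈ T, length E0 (o, x) = t := by
  induction h with
  | @edge i j h =>
    rcases h1.eq_or_lt with h1 | h1
    · exact ⟨i, by simp, h1⟩
    · refine ⟨j, by simp, le_antisymm ?_ h2⟩
      exact (length_le_length_add_one h).trans (Order.add_one_le_of_lt h1)
  | @step T₁ T₂ i k j _ _ _ ih1 ih2 =>
    rcases le_total t (length E0 (o, k)) with hk | hk
    · obtain ⟨x, hx, hx'⟩ := ih1 h1 hk
      exact ⟨x, Finset.mem_union_left _ hx, hx'⟩
    · obtain ⟨x, hx, hx'⟩ := ih2 hk h2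
      exact ⟨x, Finset.mem_union_right _ hx, hx'⟩

lemma le_card_of_le_length (h : Spans E0 Eopen T i j) {L : ℕ} (hL : (L : ℕ∞) ≤ length E0 (i, j)) :
    L ≤ T.card := by
  have h1 : (Finset.range L).image (fun m : ℕ => (m : ℕ∞)) ⊆
      T.image (fun x => length E0 (i, x)) := by
    intro t ht
    obtain ⟨m, hm, rfl⟩ := Finset.mem_image.1 ht
    have hm' : (m : ℕ∞) ≤ L := by exact_mod_cast (Finset.mem_range.1 hm).le
    obtain ⟨x, hx, hx'⟩ := h.exists_length_eq (o := i) (t := m) (by simp [length_self])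
      (hm'.trans hL)
    exact Finset.mem_image.2 ⟨x, hx, hx'⟩
  have h2 := (Finset.card_le_card h1).trans Finset.card_image_le
  rwa [Finset.card_image_of_injective _ Nat.cast_injective, Finset.card_range] at h2

/-- As long as a tree has more than `2 * L` vertices, one of its two subtrees still has at least
`L`, so descending the tree cannot jump over the window. -/
lemma exists_card_le (h : Spans E0 Eopen T i j) {L : ℕ} (hL : 1 ≤ L) (hT : L ≤ T.card) :
    ∃ T' i' j', Spans E0 Eopen T' i' j' ∧ L ≤ T'.card ∧ T'.card ≤ 2 * L := by
  induction h with
  | @edge i j h => exact ⟨_, i, j, .edge h, hT, Finset.card_le_two.trans (by omega)⟩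
  | @step T₁ T₂ i k j h1 h2 ho ih1 ih2 =>
    by_cases hc : (T₁ ∪ T₂).card ≤ 2 * L
    · exact ⟨_, i, j, .step h1 h2 ho, hT, hc⟩
    · have := Finset.card_union_le T₁ T₂
      by_cases hc1 : L ≤ T₁.card
      · exact ih1 hc1
      · exact ih2 (by omega)

lemma preconnected (h : Spans E0 Eopen T i j) :
    ((SimpleGraph.fromRel fun a b => (a, b) ∈ E0).induce (T : Set V)).Preconnected := by
  induction h with
  | @edge i j h =>
    by_cases hij : i = j
    · subst hij
      intro x y
      have : x = y := Subtype.ext (by have := x.2; have := y.2; simp_all)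
      rw [this]
    · have hadj : (SimpleGraph.fromRel fun a b => (a, b) ∈ E0).Adj i j := by
        simp [SimpleGraph.fromRel_adj, hij, h]
      rw [Finset.coe_pair]
      exact (SimpleGraph.induce_pair_connected_of_adj hadj).preconnected
  | @step T₁ T₂ i k j h1 h2 ho ih1 ih2 =>
    rw [Finset.coe_union]
    exact (SimpleGraph.induce_union_connected ih1 ih2 ⟨k, h1.mem_ends.2, h2.mem_ends.1⟩).preconnected

end Spans

/-- Every vertex is an end of a leaf. Unless the leaf is the whole tree, its sibling and the open
edge of its parent complete a triangle: a left leaf is reinforced by out-edges, a right leaf by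
in-edges. -/
lemma Spans.exists_reinforced {T : Finset V} {i j : V} (h : Spans E0 Eopen T i j) :
    ((i, j) ∈ E0 ∧ T = {i, j}) ∨
      ∀ t ∈ T, ∃ e, Reinforced E0 Eopen T e ∧ (t = e.1 ∨ t = e.2) := by
  induction h with
  | edge h => exact Or.inl ⟨h, rfl⟩
  | @step T₁ T₂ i k j h1 h2 ho ih1 ih2 =>
    right
    intro t ht
    rcases Finset.mem_union.1 ht with ht | ht
    · rcases ih1 with ⟨h, rfl⟩ | ih1
      · refine ⟨(i, k), ⟨h, by simp, by simp, Or.inr ⟨j, ?_, ho, h2.mem_edges⟩⟩, by simpa using ht⟩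
        exact Finset.mem_union_right _ h2.mem_ends.2
      · obtain ⟨e, he, hte⟩ := ih1 t ht
        exact ⟨e, he.mono Finset.subset_union_left, hte⟩
    · rcases ih2 with ⟨h, rfl⟩ | ih2
      · refine ⟨(k, j), ⟨h, by simp, by simp, Or.inl ⟨i, ?_, ho, h1.mem_edges⟩⟩, by simpa using ht⟩
        exact Finset.mem_union_left _ h1.mem_ends.1
      · obtain ⟨e, he, hte⟩ := ih2 t ht
        exact ⟨e, he.mono Finset.subset_union_right, hte⟩

end Witness

/-- A set of edges no two of which share a vertex. -/
def VertexDisjoint {V : Type*} (M : Finset (V × V)) : Prop :=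
  ∀ e ∈ M, ∀ f ∈ M, (e.1 = f.1 ∨ e.1 = f.2 ∨ e.2 = f.1 ∨ e.2 = f.2) → e = f

lemma VertexDisjoint.subset {V : Type*} {M M' : Finset (V × V)} (h : VertexDisjoint M)
    (hM : M' ⊆ M) : VertexDisjoint M' :=
  fun e he f hf => h e (hM he) f (hM hf)

/-- If every vertex of `T` is an end of an edge of `R`, then some proportion of the edges of
`R` forms a matching. -/
lemma exists_vertexDisjoint {V : Type*} [Fintype V] [DecidableEq V] {G : SimpleGraph V}
    {Δ : ℕ} (hG : ∀ v, (G.neighborSet v).ncard ≤ Δ) {T : Finset V} {R : Finset (V × V)}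
    (hRG : ∀ e ∈ R, G.Adj e.1 e.2) (hT : ∀ t ∈ T, ∃ e ∈ R, t = e.1 ∨ t = e.2) :
    ∃ M ⊆ R, VertexDisjoint M ∧ T.card ≤ M.card * (2 * (Δ + 1)) := by
  classical
  obtain ⟨M, hM, hmax⟩ := Finset.exists_max_image
    (R.powerset.filter fun M => VertexDisjoint M) Finset.card
    ⟨∅, by simp [VertexDisjoint]⟩
  simp only [Finset.mem_filter, Finset.mem_powerset] at hM hmax
  refine ⟨M, hM.1, hM.2, ?_⟩
  -- By maximality every edge of `R` meets an edge of `M`, so `T` lies in the closed neighbourhoods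
  -- of the ends of `M`.
  have hcov : T ⊆ M.biUnion fun e =>
      insert e.1 (G.neighborFinset e.1) ∪ insert e.2 (G.neighborFinset e.2) := by
    intro t ht
    obtain ⟨e, he, hte⟩ := hT t ht
    have hadj := hRG e he
    have hmeet : ∃ f ∈ M, e.1 = f.1 ∨ e.1 = f.2 ∨ e.2 = f.1 ∨ e.2 = f.2 := by
      by_contra! hc
      have heM : e ∉ M := fun h => (hc e h).1 rfl
      have := hmax (insert e M) ⟨Finset.insert_subset he hM.1, ?_⟩
      · rw [Finset.card_insert_of_notMem heM] at this
        omega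
      · intro a ha b hb hab
        rcases Finset.mem_insert.1 ha with rfl | ha' <;> rcases Finset.mem_insert.1 hb with rfl | hb'
        · rfl
        · have := hc b hb'
          tauto
        · have := hc a ha'
          grind
        · exact hM.2 a ha' b hb' hab
    obtain ⟨f, hf, hef⟩ := hmeet
    rw [Finset.mem_biUnion]
    refine ⟨f, hf, ?_⟩
    simp only [Finset.mem_union, Finset.mem_insert, SimpleGraph.mem_neighborFinset]
    have := hadj.symm
    rcases hte with rfl | rfl <;> rcases hef with h | h | h | h <;> rw [← h] <;> tauto
  refine (Finset.card_le_card hcov).trans (Finset.card_biUnion_le_card_mul _ _ _ fun e _ => ?_)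
  refine (Finset.card_union_le _ _).trans ?_
  have h1 := card_insert_neighborFinset_le G (hG e.1)
  have h2 := card_insert_neighborFinset_le G (hG e.2)
  omega

/-! ### Probability of a long occupied edge -/

lemma measureReal_biUnion_le_card_mul {Ω J : Type*} [MeasurableSpace Ω] (μ : Measure Ω)
    [IsFiniteMeasure μ]
    (s : Finset J) (f : J → Set Ω) {c : ℝ} (h : ∀ j ∈ s, μ.real (f j) ≤ c) :
    μ.real (⋃ j ∈ s, f j) ≤ s.card * c := by
  refine (measureReal_biUnion_finset_le s f).trans ?_
  simpa using Finset.sum_le_card_nsmul s _ c h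

/-- If the edges `a j x` and `b j x` are all distinct, then it is unlikely that each `j` has an
`x ∈ S` with `a j x` open and `b j x` usable. -/
lemma setBernoulli_real_forall_exists_le {ι V J : Type*} [Fintype J] [Finite ι]
    (u E0 : Set ι) (p : I) (S : Finset V) (a b : J → V → ι) {D : ℕ}
    (ha : ∀ j j' x x', a j x = a j' x' → j = j') (hb : ∀ j j' x x', b j x = b j' x' → j = j')
    (hab : ∀ j j' x x', a j x ≠ b j' x') (hD : ∀ j, {x | b j x ∈ E0}.ncard ≤ D)
    (hfin : ∀ j, {x | b j x ∈ E0}.Finite) :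
    (setBernoulli u p).real {ω | ∀ j, ∃ x ∈ S, a j x ∈ ω ∧ b j x ∈ E0 ∪ ω} ≤
      (D * p + S.card * p ^ 2 : ℝ) ^ Fintype.card J := by
  classical
  have hp := p.2.1
  set c : J → V → ℝ := fun j x => if b j x ∈ E0 then (p : ℝ) else (p : ℝ) ^ 2 with hc
  -- For a fixed choice of the vertices `x j`, these are the edges that must be open: all `a j (x
  -- j)`, and those `b j (x j)` that are not initial. Summing over choices factorises into a product
  -- over `j`.
  let F : (J → V) → Finset ι := fun x => Finset.univ.image (fun j => a j (x j)) ∪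
    (Finset.univ.filter fun j => b j (x j) ∉ E0).image (fun j => b j (x j))
  have hcard : ∀ x, (p : ℝ) ^ (F x).card = ∏ j, c j (x j) := by
    intro x
    rw [Finset.card_union_of_disjoint, Finset.card_image_of_injective,
      Finset.card_image_of_injective, pow_add, Finset.card_filter, ← Finset.prod_pow_eq_pow_sum,
      ← Finset.prod_const, ← Finset.prod_mul_distrib]
    · refine Finset.prod_congr rfl fun j _ => ?_
      by_cases h : b j (x j) ∈ E0 <;> simp [hc, h, sq]
    · exact fun j j' h => hb _ _ _ _ h
    · exact fun j j' h => ha _ _ _ _ h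
    · rw [Finset.disjoint_left]
      rintro _ h1 h2
      obtain ⟨j, _, rfl⟩ := Finset.mem_image.1 h1
      obtain ⟨j', _, h⟩ := Finset.mem_image.1 h2
      exact hab _ _ _ _ h.symm
  have hsub : {ω : Set ι | ∀ j, ∃ x ∈ S, a j x ∈ ω ∧ b j x ∈ E0 ∪ ω} ⊆
      ⋃ x ∈ Fintype.piFinset (fun _ : J => S), {ω : Set ι | ∀ i ∈ F x, i ∈ ω} := by
    intro ω hω
    choose x hx h1 h2 using hω
    rw [Set.mem_iUnion₂]
    refine ⟨x, Fintype.mem_piFinset.2 hx, fun i hi => ?_⟩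
    rcases Finset.mem_union.1 hi with hi | hi
    · obtain ⟨j, _, rfl⟩ := Finset.mem_image.1 hi
      exact h1 j
    · obtain ⟨j, hj, rfl⟩ := Finset.mem_image.1 hi
      exact (h2 j).resolve_left (Finset.mem_filter.1 hj).2
  calc _ ≤ (setBernoulli u p).real
        (⋃ x ∈ Fintype.piFinset (fun _ : J => S), {ω : Set ι | ∀ i ∈ F x, i ∈ ω}) :=
        measureReal_mono hsub (measure_ne_top _ _)
    _ ≤ ∑ x ∈ Fintype.piFinset (fun _ : J => S),
        (setBernoulli u p).real {ω : Set ι | ∀ i ∈ F x, i ∈ ω} := measureReal_biUnion_finset_le _ _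
    _ ≤ ∑ x ∈ Fintype.piFinset (fun _ : J => S), ∏ j, c j (x j) :=
        Finset.sum_le_sum fun x _ => (setBernoulli_real_subset_le u p _).trans (hcard x).le
    _ = ∏ j, ∑ x ∈ S, c j x := (Finset.prod_univ_sum _ _).symm
    _ ≤ ∏ _j : J, (D * p + S.card * p ^ 2 : ℝ) := by
        refine Finset.prod_le_prod (fun j _ => Finset.sum_nonneg fun x _ => ?_) fun j _ => ?_
        · simp only [hc]; split_ifs <;> positivity
        · rw [hc, Finset.sum_ite, Finset.sum_const, Finset.sum_const, nsmul_eq_mul, nsmul_eq_mul]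
          have h1 : (S.filter fun x => b j x ∈ E0).card ≤ D := by
            refine le_trans ?_ (hD j)
            rw [← Set.ncard_coe_finset]
            exact Set.ncard_le_ncard (fun x hx => by simpa using (Finset.mem_filter.1 hx).2) (hfin j)
          have h2 : (S.filter fun x => b j x ∉ E0).card ≤ S.card := Finset.card_filter_le _ _
          gcongr
    _ = _ := by simp

section Subcritical

variable {V : Type*} [Fintype V]

lemma ncard_neighborSet_fromRel_le {E0 : Set (V × V)} {D : ℕ}
    (hout : ∀ v, {w | (v, w) ∈ E0}.ncard ≤ D) (hin : ∀ v, {w | (w, v) ∈ E0}.ncard ≤ D) (v : V) :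
    ((SimpleGraph.fromRel fun a b => (a, b) ∈ E0).neighborSet v).ncard ≤ 2 * D := by
  have hsub : (SimpleGraph.fromRel fun a b => (a, b) ∈ E0).neighborSet v ⊆
      {w | (v, w) ∈ E0} ∪ {w | (w, v) ∈ E0} := by
    intro w hw
    exact ((SimpleGraph.fromRel_adj _ _ _).1 ((SimpleGraph.mem_neighborSet _ _ _).1 hw)).2
  have := (Set.ncard_le_ncard hsub (Set.toFinite _)).trans (Set.ncard_union_le _ _)
  have := hout v
  have := hin v
  omega

/-- A long occupied edge forces many disjoint initial edges, in a connected set of moderate size,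
to be reinforced in the same way. -/
lemma exists_reinforced_matching {E0 Eopen : Set (V × V)} {D L : ℕ} (hloop : ∀ v, (v, v) ∉ E0)
    (hout : ∀ v, {w | (v, w) ∈ E0}.ncard ≤ D) (hin : ∀ v, {w | (w, v) ∈ E0}.ncard ≤ D)
    (hL : 3 ≤ L) {e : V × V} (he : e ∈ eventuallyOccupied E0 Eopen)
    (hlen : (L : ℕ∞) ≤ length E0 e) :
    ∃ v, ∃ S ∈ walkSupports (SimpleGraph.fromRel fun a b => (a, b) ∈ E0) (4 * L) v,
      S.card ≤ 2 * L ∧ ∃ M : Finset (V × V), (M : Set (V × V)) ⊆ E0 ∧ M ⊆ S ×ˢ S ∧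
        VertexDisjoint M ∧ M.card = L / (8 * D + 4) ∧
        ((∀ e ∈ M, ReinforcedIn E0 Eopen S e) ∨ ∀ e ∈ M, ReinforcedOut E0 Eopen S e) := by
  classical
  obtain ⟨T, hT⟩ := exists_spans he
  obtain ⟨S, i, j, hS, hS1, hS2⟩ := hT.exists_card_le (L := L) (by omega)
    (hT.le_card_of_le_length hlen)
  refine ⟨i, S, mem_walkSupports_of_preconnected hS.mem_ends.1 hS.preconnected (by omega), hS2, ?_⟩
  have hreinf : ∀ t ∈ S, ∃ e, Reinforced E0 Eopen S e ∧ (t = e.1 ∨ t = e.2) := by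
    rcases hS.exists_reinforced with ⟨_, h⟩ | h
    · have := Finset.card_le_two (a := i) (b := j)
      rw [h] at hS1
      omega
    · exact h
  obtain ⟨M, hMR, hMd, hMc⟩ := exists_vertexDisjoint (T := S)
    (R := Finset.univ.filter (Reinforced E0 Eopen S))
    (ncard_neighborSet_fromRel_le hout hin)
    (fun e he => by
      have h0 := (Finset.mem_filter.1 he).2.1
      rw [SimpleGraph.fromRel_adj]
      refine ⟨fun h => hloop e.1 ?_, Or.inl h0⟩
      have : e = (e.1, e.1) := Prod.ext rfl h.symm
      rwa [← this])
    (fun t ht => by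
      obtain ⟨e, he, hte⟩ := hreinf t ht
      exact ⟨e, by simpa using he, hte⟩)
  have hMR' : ∀ e ∈ M, Reinforced E0 Eopen S e := fun e he => (Finset.mem_filter.1 (hMR he)).2
  -- The symmetrised graph has degrees at most `2 * D`, so `M` has at least `L / (4 * D + 2)` edges;
  -- the remaining factor `2` lets one of the two kinds of reinforcement be selected.
  set r := L / (8 * D + 4) with hr
  have hrM : 2 * r ≤ M.card := by
    have h1 : r * (8 * D + 4) ≤ L := Nat.div_mul_le_self _ _
    have h2 : (2 * r) * (2 * (2 * D + 1)) ≤ M.card * (2 * (2 * D + 1)) := by nlinarith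
    exact Nat.le_of_mul_le_mul_right h2 (by omega)
  have hsplit := Finset.card_filter_add_card_filter_not (s := M) (ReinforcedIn E0 Eopen S)
  have main : ∀ M' ⊆ M, r ≤ M'.card → ∃ N ⊆ M', (N : Set (V × V)) ⊆ E0 ∧ N ⊆ S ×ˢ S ∧
      VertexDisjoint N ∧ N.card = r := by
    intro M' hM' hrM'
    obtain ⟨N, hN, hNr⟩ := Finset.exists_subset_card_eq hrM'
    refine ⟨N, hN, fun e he => (hMR' e (hM' (hN he))).1, fun e he => ?_,
      hMd.subset (hN.trans hM'), hNr⟩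
    have := hMR' e (hM' (hN he))
    exact Finset.mem_product.2 ⟨this.2.1, this.2.2.1⟩
  by_cases hc : r ≤ (M.filter (ReinforcedIn E0 Eopen S)).card
  · obtain ⟨N, hN, h0, h1, h2, h3⟩ := main _ (Finset.filter_subset _ _) hc
    exact ⟨N, h0, h1, h2, h3, Or.inl fun e he => (Finset.mem_filter.1 (hN he)).2⟩
  · obtain ⟨N, hN, h0, h1, h2, h3⟩ := main (M.filter fun e => ¬ ReinforcedIn E0 Eopen S e)
      (Finset.filter_subset _ _) (by omega)
    refine ⟨N, h0, h1, h2, h3, Or.inr fun e he => ?_⟩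
    have := Finset.mem_filter.1 (hN he)
    exact (hMR' e this.1).2.2.2.resolve_left this.2

/-- The edges used for in-reinforcement end at vertices of the matching, and those for
out-reinforcement start there. As these vertices are all distinct, so are the edges required to be
open, whatever the apexes. -/
lemma openLaw_real_reinforced_le {E0 : Set (V × V)} {D : ℕ} (p : I) (hloop : ∀ v, (v, v) ∉ E0)
    (hout : ∀ v, {w | (v, w) ∈ E0}.ncard ≤ D) (hin : ∀ v, {w | (w, v) ∈ E0}.ncard ≤ D)
    (S : Finset V) {M : Finset (V × V)} (hMd : VertexDisjoint M) (hME : ∀ e ∈ M, e ∈ E0) :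
    (openLaw E0 p).real ({Eopen | ∀ e ∈ M, ReinforcedIn E0 Eopen S e} ∪
        {Eopen | ∀ e ∈ M, ReinforcedOut E0 Eopen S e}) ≤
      2 * (D * p + S.card * p ^ 2 : ℝ) ^ M.card := by
  classical
  have hne : ∀ e f, e ∈ M → f ∈ M → e.1 ≠ f.2 := by
    intro e f he hf h
    have hef := hMd e he f hf (Or.inr (Or.inl h))
    subst hef
    refine hloop e.1 ?_
    have : e = (e.1, e.1) := Prod.ext rfl h.symm
    rw [← this]
    exact hME e he
  have h1 := setBernoulli_real_forall_exists_le {e | e.1 ≠ e.2 ∧ e ∉ E0} E0 p S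
    (J := M) (D := D) (fun e x => (x, e.1.2)) (fun e x => (x, e.1.1))
    (fun e f x x' h => Subtype.ext (hMd _ e.2 _ f.2 (by simp_all)))
    (fun e f x x' h => Subtype.ext (hMd _ e.2 _ f.2 (by simp_all)))
    (fun e f x x' h => hne f e f.2 e.2 (by simp_all))
    (fun e => hin _) (fun e => Set.toFinite _)
  have h2 := setBernoulli_real_forall_exists_le {e | e.1 ≠ e.2 ∧ e ∉ E0} E0 p S
    (J := M) (D := D) (fun e x => (e.1.1, x)) (fun e x => (e.1.2, x))
    (fun e f x x' h => Subtype.ext (hMd _ e.2 _ f.2 (by simp_all)))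
    (fun e f x x' h => Subtype.ext (hMd _ e.2 _ f.2 (by simp_all)))
    (fun e f x x' h => hne e f e.2 f.2 (by simp_all))
    (fun e => hout _) (fun e => Set.toFinite _)
  refine (measureReal_union_le _ _).trans ?_
  rw [two_mul]
  refine add_le_add (le_trans (le_of_eq ?_) (by simpa using h1))
    (le_trans (le_of_eq ?_) (by simpa using h2))
  · rw [openLaw]; congr 1; ext ω; simp [ReinforcedIn]
  · rw [openLaw]; congr 1; ext ω; simp [ReinforcedOut]

open Classical in
lemma card_filter_mem_product_le {E0 : Set (V × V)} {D : ℕ}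
    (hout : ∀ v, {w | (v, w) ∈ E0}.ncard ≤ D) (S : Finset V) :
    ((S ×ˢ S).filter (· ∈ E0)).card ≤ S.card * D := by
  have hcov : (S ×ˢ S).filter (· ∈ E0) ⊆ S.biUnion fun v => (Finset.univ.filter fun e : V × V =>
      e.1 = v ∧ e ∈ E0) := by
    intro e he
    obtain ⟨h1, h2⟩ := Finset.mem_filter.1 he
    simpa [h2] using (Finset.mem_product.1 h1).1
  refine (Finset.card_le_card hcov).trans (Finset.card_biUnion_le_card_mul _ _ D fun v _ => ?_)
  refine le_trans ?_ (hout v)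
  have : (Finset.univ.filter fun e : V × V => e.1 = v ∧ e ∈ E0) =
      (Finset.univ.filter fun w => (v, w) ∈ E0).image (fun w => (v, w)) := by
    ext ⟨a, b⟩
    simp only [Finset.mem_filter, Finset.mem_univ, true_and, Finset.mem_image, Prod.mk.injEq]
    grind
  rw [this]
  refine Finset.card_image_le.trans ?_
  rw [← Set.ncard_coe_finset]
  simp

/-- A union bound: the factors count a root vertex, a connected set through it, and a set of initial
edges inside, at most `2 * L * D` being available. -/
lemma openLaw_real_long_le {E0 : Set (V × V)} {D L : ℕ} (p : I) (hloop : ∀ v, (v, v) ∉ E0)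
    (hout : ∀ v, {w | (v, w) ∈ E0}.ncard ≤ D) (hin : ∀ v, {w | (w, v) ∈ E0}.ncard ≤ D)
    (hL : 3 ≤ L) :
    (openLaw E0 p).real {Eopen | ∃ e ∈ eventuallyOccupied E0 Eopen, (L : ℕ∞) ≤ length E0 e} ≤
      Fintype.card V * ((2 * D + 1) ^ (4 * L) * (2 ^ (2 * L * D) *
        (2 * (D * p + (2 * L) * p ^ 2 : ℝ) ^ (L / (8 * D + 4))))) := by
  classical
  have hp := p.2.1
  have : IsProbabilityMeasure (openLaw E0 p) := by rw [openLaw]; infer_instance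
  set G := SimpleGraph.fromRel fun a b => (a, b) ∈ E0 with hG
  set r := L / (8 * D + 4)
  let cand : V → Finset (Finset V) := fun v => (walkSupports G (4 * L) v).filter (·.card ≤ 2 * L)
  let inner : Finset V → Finset (V × V) := fun S => (S ×ˢ S).filter (· ∈ E0)
  let mat : Finset V → Finset (Finset (V × V)) := fun S =>
    (inner S).powerset.filter fun M => VertexDisjoint M ∧ M.card = r
  let A : Finset V → Finset (V × V) → Set (Set (V × V)) := fun S M =>
    {Eopen | ∀ e ∈ M, ReinforcedIn E0 Eopen S e} ∪ {Eopen | ∀ e ∈ M, ReinforcedOut E0 Eopen S e}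
  have hsub : {Eopen | ∃ e ∈ eventuallyOccupied E0 Eopen, (L : ℕ∞) ≤ length E0 e} ⊆
      ⋃ v ∈ (Finset.univ : Finset V), ⋃ S ∈ cand v, ⋃ M ∈ mat S, A S M := by
    rintro Eopen ⟨e, he, hlen⟩
    obtain ⟨v, S, hS, hSc, M, h1, h2, h3, h4, h5⟩ :=
      exists_reinforced_matching hloop hout hin hL he hlen
    simp only [Set.mem_iUnion]
    refine ⟨v, Finset.mem_univ _, S, Finset.mem_filter.2 ⟨hS, hSc⟩, M, ?_, h5⟩
    refine Finset.mem_filter.2 ⟨Finset.mem_powerset.2 fun e he => ?_, h3, h4⟩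
    exact Finset.mem_filter.2 ⟨h2 he, h1 he⟩
  have hSL : ∀ v, ∀ S ∈ cand v, S.card ≤ 2 * L := fun v S hS => (Finset.mem_filter.1 hS).2
  have hA : ∀ S : Finset V, S.card ≤ 2 * L → ∀ M ∈ mat S, (openLaw E0 p).real (A S M) ≤
      2 * (D * p + (2 * L) * p ^ 2 : ℝ) ^ r := by
    intro S hS M hM
    obtain ⟨hM0, hMd, hMr⟩ := Finset.mem_filter.1 hM
    have hME : ∀ e ∈ M, e ∈ E0 := fun e he =>
      (Finset.mem_filter.1 (Finset.mem_powerset.1 hM0 he)).2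
    refine (openLaw_real_reinforced_le p hloop hout hin S hMd hME).trans ?_
    rw [hMr]
    have : (S.card : ℝ) ≤ 2 * L := by exact_mod_cast hS
    gcongr
  have hinner : ∀ S : Finset V, S.card ≤ 2 * L → (mat S).card ≤ 2 ^ (2 * L * D) := by
    intro S hS
    refine (Finset.card_filter_le _ _).trans ?_
    rw [Finset.card_powerset]
    exact Nat.pow_le_pow_right (by omega)
      ((card_filter_mem_product_le hout S).trans (Nat.mul_le_mul_right _ hS))
  have hcand : ∀ v, (cand v).card ≤ (2 * D + 1) ^ (4 * L) := fun v =>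
    (Finset.card_filter_le _ _).trans
      (card_walkSupports_le (ncard_neighborSet_fromRel_le hout hin) _ _)
  clear_value A mat cand r
  set c : ℝ := 2 * (D * p + (2 * L) * p ^ 2 : ℝ) ^ r with hc
  have hpos : 0 ≤ c := by positivity
  clear_value c
  have hmat : ∀ v, ∀ S ∈ cand v,
      (openLaw E0 p).real (⋃ M ∈ mat S, A S M) ≤ 2 ^ (2 * L * D) * c := by
    intro v S hS
    have h1 : ((mat S).card : ℝ) ≤ 2 ^ (2 * L * D) := by exact_mod_cast hinner S (hSL v S hS)
    exact (measureReal_biUnion_le_card_mul _ _ _ (hA S (hSL v S hS))).trans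
      (mul_le_mul_of_nonneg_right h1 hpos)
  have hv : ∀ v ∈ (Finset.univ : Finset V), (openLaw E0 p).real (⋃ S ∈ cand v, ⋃ M ∈ mat S, A S M) ≤
      (2 * D + 1) ^ (4 * L) * (2 ^ (2 * L * D) * c) := by
    intro v _
    have h1 : ((cand v).card : ℝ) ≤ (2 * D + 1) ^ (4 * L) := by exact_mod_cast hcand v
    exact (measureReal_biUnion_le_card_mul _ _ _ (hmat v)).trans
      (mul_le_mul_of_nonneg_right h1 (by positivity))
  exact (measureReal_mono hsub (measure_ne_top _ _)).trans
    (measureReal_biUnion_le_card_mul _ _ _ hv)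

end Subcritical

instance {V : Type*} (E0 : Set (V × V)) (p : I) : IsProbabilityMeasure (openLaw E0 p) := by
  rw [openLaw]; infer_instance

lemma natCeil_le_of_ofReal_le {x : ℝ} {l : ℕ∞} (h : ENNReal.ofReal x ≤ (l : ℝ≥0∞)) :
    ((⌈x⌉₊ : ℕ) : ℕ∞) ≤ l := by
  induction l using ENat.recTopCoe with
  | top => exact le_top
  | coe m =>
    rw [Nat.cast_le, Nat.ceil_le]
    simpa using ENNReal.ofReal_le_iff_le_toReal (by simp) |>.1 h

lemma tendsto_log_natCast_atTop : Tendsto (fun n : ℕ => Real.log n) atTop atTop :=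
  Real.tendsto_log_atTop.comp tendsto_natCast_atTop_atTop

/-- For an exponentially small base, the union bound over connected sets of size about
`α log n` is of order `1 / n`. -/
lemma union_bound_le {α K B : ℝ} {N L n : ℕ} {x : ℝ} (hα : 0 < α) (hK : 0 < K) (hN : 0 < N)
    (hB : B = Real.log K + 2 / α) (hB0 : 0 ≤ B) (hn : 0 < n) (hL : α * Real.log n ≤ L) (hx0 : 0 ≤ x)
    (hx : x ≤ Real.exp (-(B * N))) :
    n * (K ^ L * (2 * x ^ (L / N))) ≤ 2 * Real.exp (B * N) / n := by
  have hn' : (0 : ℝ) < n := by exact_mod_cast hn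
  have h1 : x ^ (L / N) ≤ Real.exp (B * N) * Real.exp (-(B * L)) := by
    calc x ^ (L / N) ≤ Real.exp (-(B * N)) ^ (L / N) := by gcongr
      _ = Real.exp (((L / N : ℕ) : ℝ) * (-(B * N))) := by rw [Real.exp_nat_mul]
      _ ≤ Real.exp (B * N + -(B * L)) := by
        apply Real.exp_le_exp.2
        have h2 : (L : ℝ) ≤ N * ((L / N : ℕ) : ℝ) + N := by
          exact_mod_cast (Nat.lt_mul_div_succ L hN).le.trans_eq (by ring)
        nlinarith
      _ = _ := Real.exp_add _ _
  -- The `log K` in `B` cancels the entropy and the `2 / α` leaves `exp (-2 * L / α) ≤ n⁻²`. The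
  -- prefactor `exp (B * N)` pays for the rounding in `L / N`.
  have h2 : K ^ L * Real.exp (-(B * L)) ≤ 1 / (n : ℝ) ^ 2 := by
    have hKL : K ^ L = Real.exp (L * Real.log K) := by
      rw [Real.exp_nat_mul, Real.exp_log hK]
    have hn2 : 1 / (n : ℝ) ^ 2 = Real.exp (-(2 * Real.log n)) := by
      rw [Real.exp_neg, ← Real.log_rpow hn', Real.exp_log (by positivity)]
      norm_num
    rw [hKL, hn2, ← Real.exp_add]
    apply Real.exp_le_exp.2
    rw [hB]
    have : 2 * Real.log n ≤ 2 / α * L := by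
      rw [div_mul_eq_mul_div, le_div_iff₀ hα]
      nlinarith
    nlinarith
  calc (n : ℝ) * (K ^ L * (2 * x ^ (L / N)))
      ≤ n * (K ^ L * (2 * (Real.exp (B * N) * Real.exp (-(B * L))))) := by gcongr
    _ = 2 * Real.exp (B * N) * n * (K ^ L * Real.exp (-(B * L))) := by ring
    _ ≤ 2 * Real.exp (B * N) * n * (1 / (n : ℝ) ^ 2) := by gcongr
    _ = _ := by field_simp

theorem exists_tendsto_long (D : ℕ) (α : ℝ) (hα : 0 < α) : ∃ c : ℝ, 0 < c ∧
      ∀ (E0 : (n : ℕ) → Set (Fin n × Fin n)) (p : ℕ → I),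
        (∀ᶠ n in atTop, ∀ v, (v, v) ∉ E0 n ∧
          {w | (v, w) ∈ E0 n}.ncard ≤ D ∧ {w | (w, v) ∈ E0 n}.ncard ≤ D) →
        (∀ᶠ n : ℕ in atTop, (p n : ℝ) < c / √(Real.log n)) →
        Tendsto (fun n : ℕ => openLaw (E0 n) (p n)
            {Eopen | ∃ e ∈ eventuallyOccupied (E0 n) Eopen,
              ENNReal.ofReal (α * Real.log n) ≤ (length (E0 n) e : ℝ≥0∞)})
          atTop (𝓝 0) := by
  set K : ℝ := (2 * D + 1) ^ 4 * 2 ^ (2 * D) with hK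
  set N : ℕ := 8 * D + 4 with hN
  have hK1 : 1 ≤ K := by
    rw [hK]
    refine one_le_mul_of_one_le_of_one_le (one_le_pow₀ ?_) (one_le_pow₀ (by norm_num))
    linarith [(Nat.cast_nonneg D : (0 : ℝ) ≤ D)]
  set B : ℝ := Real.log K + 2 / α with hB
  have hB0 : 0 ≤ B := add_nonneg (Real.log_nonneg hK1) (by positivity)
  set ε : ℝ := Real.exp (-(B * N)) with hε
  have hε0 : 0 < ε := Real.exp_pos _
  -- Since eventually `L ≤ 2 * α * log n`, this `c` gives `2 * L * p ^ 2 ≤ 4 * α * c ^ 2 = ε / 2`;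
  -- the other half of `ε` is for `D * p`, which tends to `0`.
  refine ⟨√(ε / (8 * α)), by positivity, fun E0 p hE0 hp => ?_⟩
  set c := √(ε / (8 * α)) with hc
  have hc2 : c ^ 2 = ε / (8 * α) := Real.sq_sqrt (by positivity)
  have hlog := tendsto_log_natCast_atTop
  have hsqrt : Tendsto (fun n : ℕ => D * (c / √(Real.log n))) atTop (𝓝 0) := by
    have h := (tendsto_const_nhds (x := c)).div_atTop (Real.tendsto_sqrt_atTop.comp hlog)
    simpa using h.const_mul (D : ℝ)
  have hlim : Tendsto (fun n : ℕ => ENNReal.ofReal (2 * Real.exp (B * N) / n)) atTop (𝓝 0) := by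
    have h := tendsto_const_div_atTop_nhds_zero_nat (2 * Real.exp (B * N))
    simpa using ENNReal.tendsto_ofReal h
  refine tendsto_of_tendsto_of_tendsto_of_le_of_le' tendsto_const_nhds hlim
    (Eventually.of_forall fun _ => zero_le) ?_
  filter_upwards [hE0, hp, hlog.eventually_ge_atTop 1, hlog.eventually_ge_atTop (1 / α),
    hlog.eventually_gt_atTop (2 / α), hsqrt.eventually_le_const (half_pos hε0),
    eventually_gt_atTop 0] with n hE hpn hl1 hlα hl3 hDn hn
  set L := ⌈α * Real.log n⌉₊ with hL
  have hL1 : α * Real.log n ≤ L := Nat.le_ceil _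
  have hL3 : 3 ≤ L := by
    have : (2 : ℝ) < L := by
      rw [div_lt_iff₀ hα] at hl3
      linarith
    exact_mod_cast this
  have hL2 : (L : ℝ) ≤ 2 * (α * Real.log n) := by
    have h1 : 1 ≤ α * Real.log n := by
      rw [div_le_iff₀ hα] at hlα
      linarith
    have := (Nat.ceil_lt_add_one (by positivity : 0 ≤ α * Real.log n)).le
    rw [← hL] at this
    linarith
  have hp0 := (p n).2.1
  have hx0 : (0 : ℝ) ≤ D * p n + (2 * L) * p n ^ 2 := by positivity
  have hx : (D * p n + (2 * L) * p n ^ 2 : ℝ) ≤ ε := by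
    have h1 : (D * p n : ℝ) ≤ ε / 2 := le_trans (by gcongr) hDn
    have h2 : (p n : ℝ) ^ 2 ≤ c ^ 2 / Real.log n := by
      calc (p n : ℝ) ^ 2 ≤ (c / √(Real.log n)) ^ 2 := by gcongr
        _ = _ := by rw [div_pow, Real.sq_sqrt (x := Real.log n) (by linarith)]
    have h3 : (2 * L) * (p n : ℝ) ^ 2 ≤ ε / 2 := by
      calc (2 * L) * (p n : ℝ) ^ 2 ≤ (2 * (2 * (α * Real.log n))) * (c ^ 2 / Real.log n) := by gcongr
        _ = ε / 2 := by
          rw [hc2]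
          have : Real.log n ≠ 0 := by linarith
          field_simp
          ring
    linarith
  have hbound := openLaw_real_long_le (L := L) (p n) (fun v => (hE v).1) (fun v => (hE v).2.1)
    (fun v => (hE v).2.2) hL3
  have hfin := union_bound_le (N := N) hα (by linarith) (by omega) hB hB0 hn hL1 hx0 hx
  have hKL : ((2 * D + 1 : ℝ) ^ (4 * L) * (2 ^ (2 * L * D) *
      (2 * (D * p n + (2 * L) * p n ^ 2 : ℝ) ^ (L / (8 * D + 4))))) =
      K ^ L * (2 * (D * p n + (2 * L) * p n ^ 2 : ℝ) ^ (L / N)) := by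
    rw [hK, mul_pow, ← pow_mul, ← pow_mul, show 2 * D * L = 2 * L * D by ring, hN]
    ring
  rw [hKL, Fintype.card_fin] at hbound
  refine le_trans (measure_mono ?_) ((ENNReal.le_ofReal_iff_toReal_le (measure_ne_top _ _)
    (by positivity)).2 (hbound.trans hfin))
  rintro Eopen ⟨e, he, hlen⟩
  exact ⟨e, he, natCeil_le_of_ofReal_le hlen⟩

theorem exists_tendsto_not_long (D : ℕ) (α : ℝ) (hα : 0 < α) : ∃ c : ℝ, 0 < c ∧
      ∀ (G : (n : ℕ) → SimpleGraph (Fin n)) (p : ℕ → I),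
        (∀ᶠ n in atTop, ∀ v, ((G n).neighborSet v).ncard ≤ D) →
        (∀ᶠ n : ℕ in atTop, (p n : ℝ) < c * (1 / √(Real.log n))) →
          Tendsto (fun n : ℕ => openLaw (edges (G n)) (p n)
              {Eopen | ¬ ∃ e ∈ eventuallyOccupied (edges (G n)) Eopen,
                ENNReal.ofReal (α * Real.log n) < (length (edges (G n)) e : ℝ≥0∞)})
            atTop (𝓝 1) := by
  obtain ⟨c, hc, h⟩ := exists_tendsto_long D α hα
  refine ⟨c, hc, fun G p hG hp => ?_⟩
  have h1 := h (fun n => edges (G n)) p ?_ ?_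
  · have h2 := ENNReal.Tendsto.sub (tendsto_const_nhds (x := (1 : ℝ≥0∞))) h1 (by simp)
    rw [tsub_zero] at h2
    refine tendsto_of_tendsto_of_tendsto_of_le_of_le h2 tendsto_const_nhds (fun n => ?_)
      (fun n => prob_le_one)
    rw [← prob_compl_eq_one_sub MeasurableSet.of_discrete]
    refine measure_mono fun Eopen h => ?_
    rintro ⟨e, he, hlen⟩
    exact h ⟨e, he, hlen.le⟩
  · filter_upwards [hG] with n hn v
    refine ⟨fun hv => (G n).irrefl hv, hn v, ?_⟩
    have : {w | (w, v) ∈ edges (G n)} = (G n).neighborSet v := by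
      ext w; exact (G n).adj_comm w v
    rw [this]; exact hn v
  · filter_upwards [hp] with n hn
    simpa [div_eq_mul_inv] using hn

/-! ### Disjoint connected sets of a given size -/

section Disjoint

variable {V : Type*} [DecidableEq V]

lemma exists_preconnected_subset {G : SimpleGraph V} {T : Finset V}
    (hT : (G.induce (T : Set V)).Preconnected) {k : ℕ} (hk0 : 0 < k) (hk : k ≤ T.card) :
    ∃ A ⊆ T, A.card = k ∧ (G.induce (A : Set V)).Preconnected := by
  obtain ⟨v, hv⟩ : T.Nonempty := Finset.card_pos.1 (by omega)
  obtain ⟨q, h1, h2, _⟩ := exists_walk_card_support hv hT (k := k - 1) (by omega)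
  refine ⟨_, h1, by omega, ?_⟩
  have : ((q.support.toFinset : Finset V) : Set V) = {v | v ∈ q.support} := by ext; simp
  rw [this]
  exact q.connected_induce_support.preconnected

/-- The vertices which can be reached from `v` by a walk that avoids `U`. -/
def reachAvoiding (G : SimpleGraph V) (U : Finset V) (v : V) : Set V :=
  {x | ∃ q : G.Walk v x, ∀ y ∈ q.support, y ∉ U}

lemma preconnected_reachAvoiding (G : SimpleGraph V) (U : Finset V) (v : V) :
    (G.induce (reachAvoiding G U v)).Preconnected := by
  have key : ∀ x : reachAvoiding G U v, ∃ hv : v ∈ reachAvoiding G U v,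
      (G.induce (reachAvoiding G U v)).Reachable ⟨v, hv⟩ x := by
    rintro ⟨x, q, hq⟩
    have hsub : ∀ y ∈ q.support, y ∈ reachAvoiding G U v := fun y hy =>
      ⟨q.takeUntil y hy, fun z hz => hq z (q.support_takeUntil_subset_support hy hz)⟩
    exact ⟨_, ⟨q.induce _ hsub⟩⟩
  intro x y
  obtain ⟨_, hx⟩ := key x
  obtain ⟨_, hy⟩ := key y
  exact hx.symm.trans hy

/-- A connected graph of bounded degree has many disjoint connected sets of a given size. -/
lemma exists_disjoint_preconnected [Fintype V] {G : SimpleGraph V} (hG : G.Connected) {Δ k : ℕ}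
    (hΔ : ∀ v, (G.neighborSet v).ncard ≤ Δ) (hk0 : 0 < k) (hk : k ≤ Fintype.card V) :
    ∃ F : Finset (Finset V), (∀ A ∈ F, A.card = k ∧ (G.induce (A : Set V)).Preconnected) ∧
      (F : Set (Finset V)).PairwiseDisjoint id ∧
      Fintype.card V ≤ F.card * (k * (1 + Δ * k)) := by
  classical
  let P : Finset (Finset V) → Prop := fun F =>
    (∀ A ∈ F, A.card = k ∧ (G.induce (A : Set V)).Preconnected) ∧
      (F : Set (Finset V)).PairwiseDisjoint id
  obtain ⟨F, hF, hmax⟩ := Finset.exists_max_image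
    ((Finset.univ : Finset (Finset (Finset V))).filter P) Finset.card ⟨∅, by simp [P]⟩
  simp only [Finset.mem_filter, Finset.mem_univ, true_and] at hF hmax
  refine ⟨F, hF.1, hF.2, ?_⟩
  set U := F.biUnion id with hU
  -- Otherwise a connected `k`-subset of `T` would enlarge the maximal family.
  have hext : ∀ T : Finset V, (G.induce (T : Set V)).Preconnected → Disjoint T U → T.card < k := by
    intro T hT hTU
    by_contra! hc
    obtain ⟨A, hAT, hAk, hA⟩ := exists_preconnected_subset hT hk0 hc
    have hdisj : ∀ B ∈ F, Disjoint A B := fun B hB =>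
      (hTU.mono_left hAT).mono_right (Finset.subset_biUnion_of_mem id hB)
    have hAF : A ∉ F := by
      intro h
      have := Finset.disjoint_self_iff_empty _ |>.1 (hdisj A h)
      rw [this] at hAk
      simp at hAk
      omega
    have := hmax (insert A F) ⟨?_, ?_⟩
    · rw [Finset.card_insert_of_notMem hAF] at this
      omega
    · intro B hB
      rcases Finset.mem_insert.1 hB with rfl | hB
      · exact ⟨hAk, hA⟩
      · exact hF.1 B hB
    · rw [Finset.coe_insert]
      exact hF.2.insert fun B hB _ => hdisj B hB
  have hUne : U.Nonempty := by
    by_contra hc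
    rw [Finset.not_nonempty_iff_eq_empty] at hc
    have := hext Finset.univ (by
      rw [Finset.coe_univ]
      exact (SimpleGraph.induceUnivIso G).connected_iff.2 hG |>.preconnected) (by simp [hc])
    rw [Finset.card_univ] at this
    omega
  have hreach : ∀ v, (reachAvoiding G U v).toFinset.card ≤ k := by
    intro v
    refine (hext _ ?_ ?_).le
    · rw [Set.coe_toFinset]
      exact preconnected_reachAvoiding G U v
    · rw [Finset.disjoint_left]
      intro x hx
      obtain ⟨q, hq⟩ := Set.mem_toFinset.1 hx
      exact hq x q.end_mem_support
  -- Each component of the complement of `U` is adjacent to `U`, as `G` is connected, and has at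
  -- most `k` vertices by `hreach`.
  have hcov : (Finset.univ : Finset V) ⊆ U ∪ U.biUnion fun y =>
      (G.neighborFinset y).biUnion fun x => (reachAvoiding G U x).toFinset := by
    intro v _
    by_cases hv : v ∈ U
    · exact Finset.mem_union_left _ hv
    refine Finset.mem_union_right _ ?_
    obtain ⟨u, hu⟩ := hUne
    obtain ⟨q⟩ := hG.preconnected v u
    obtain ⟨d, _, ⟨q', hq'⟩, h2⟩ := q.exists_boundary_dart (reachAvoiding G U v)
      ⟨.nil, by simpa using hv⟩ (fun ⟨q, hq⟩ => hq u q.end_mem_support hu)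
    have hdU : d.snd ∈ U := by
      by_contra hc
      refine h2 ⟨q'.concat d.adj, fun y hy => ?_⟩
      rw [SimpleGraph.Walk.support_concat, List.mem_append, List.mem_singleton] at hy
      rcases hy with hy | rfl
      · exact hq' y hy
      · exact hc
    simp only [Finset.mem_biUnion, SimpleGraph.mem_neighborFinset, Set.mem_toFinset]
    exact ⟨d.snd, hdU, d.fst, d.adj.symm, q'.reverse, fun y hy => hq' y (by simpa using hy)⟩
  have hUcard : U.card ≤ F.card * k :=
    Finset.card_biUnion_le_card_mul _ _ _ fun A hA => (hF.1 A hA).1.le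
  calc Fintype.card V = (Finset.univ : Finset V).card := Finset.card_univ.symm
    _ ≤ U.card + U.card * (Δ * k) := by
      refine (Finset.card_le_card hcov).trans ((Finset.card_union_le _ _).trans ?_)
      gcongr
      refine Finset.card_biUnion_le_card_mul _ _ _ fun y _ => ?_
      refine (Finset.card_biUnion_le_card_mul _ _ k fun x _ => hreach x).trans ?_
      gcongr
      rw [← Set.ncard_coe_finset, SimpleGraph.coe_neighborFinset]
      exact hΔ y
    _ = U.card * (1 + Δ * k) := by ring
    _ ≤ F.card * k * (1 + Δ * k) := by gcongr
    _ = _ := by ring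

end Disjoint

/-! ### Growth of saturated sets -/

section Growth

variable {V : Type*}

/-- `X` is closed under completing a pair of consecutive edges by an edge of `ω`. -/
def ClosedUnder (ω X : Set (V × V)) : Prop :=
  ∀ ⦃i k j⦄, i ≠ j → (i, j) ∈ ω → (i, k) ∈ X → (k, j) ∈ X → (i, j) ∈ X

/-- All edges of `ω` between vertices of `S` are in `X`. -/
def SaturatedOn (ω X : Set (V × V)) (S : Finset V) : Prop :=
  ∀ x ∈ S, ∀ y ∈ S, x ≠ y → (x, y) ∈ ω → (x, y) ∈ X

variable {ω X η : Set (V × V)} {S : Finset V}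

/-- The rule is invariant under reversal of all edges, so statements on edges into a vertex also
give those on edges out of it. -/
lemma ClosedUnder.swap (h : ClosedUnder ω X) :
    ClosedUnder (Prod.swap ⁻¹' ω) (Prod.swap ⁻¹' X) :=
  fun _ _ _ hij ho h1 h2 => h hij.symm ho h2 h1

lemma SaturatedOn.swap (h : SaturatedOn ω X S) :
    SaturatedOn (Prod.swap ⁻¹' ω) (Prod.swap ⁻¹' X) S :=
  fun x hx y hy hxy ho => h y hy x hx hxy.symm ho

lemma saturatedOn_of_star (hX : ClosedUnder ω X) {z : V}
    (hz : ∀ x ∈ S, x ≠ z → (z, x) ∈ X ∧ (x, z) ∈ X) : SaturatedOn ω X S := by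
  intro x hx y hy hxy ho
  by_cases hxz : x = z
  · subst hxz; exact (hz y hy hxy.symm).1
  by_cases hyz : y = z
  · subst hyz; exact (hz x hx hxz).2
  exact hX hxy ho (hz x hx hxz).2 (hz y hy hyz).1

/-- Occupation of the out-star of `z` spreads along `G`: if `(z, a)` is occupied and `a` is adjacent
to `b`, the open edge `(z, b)` is completed. Connectedness of `S` leaves no boundary at which this
stops. -/
lemma ClosedUnder.mem_of_star {G : SimpleGraph V} (hX : ClosedUnder ω X) (hG : edges G ⊆ X)
    (hS : (G.induce (S : Set V)).Preconnected) {z : V} (hzS : z ∈ S)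
    (hz : ∀ x ∈ S, x ≠ z → (z, x) ∈ ω) {x : V} (hx : x ∈ S) (hxz : x ≠ z) : (z, x) ∈ X := by
  by_contra hc
  obtain ⟨a, ha, b, hb, hbA, hab⟩ := exists_boundary_adj
    (A := {x | x = z ∨ (z, x) ∈ X}) hS hzS (Or.inl rfl) hx (not_or.2 ⟨hxz, hc⟩)
  have hbA' := not_or.1 hbA
  have habX : (a, b) ∈ X := hG hab
  rcases ha with rfl | ha
  · exact hbA'.2 habX
  · exact hbA'.2 (hX (Ne.symm hbA'.1) (hz b hb hbA'.1) ha habX)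

lemma edges_swap (G : SimpleGraph V) : Prod.swap ⁻¹' edges G = edges G := by
  ext e; exact G.adj_comm _ _

lemma saturatedOn_of_open_star {G : SimpleGraph V} (hX : ClosedUnder ω X) (hG : edges G ⊆ X)
    (hS : (G.induce (S : Set V)).Preconnected) {z : V} (hzS : z ∈ S)
    (hz : ∀ x ∈ S, x ≠ z → (z, x) ∈ ω ∧ (x, z) ∈ ω) : SaturatedOn ω X S :=
  saturatedOn_of_star hX fun x hx hxz =>
    ⟨hX.mem_of_star hG hS hzS (fun x hx h => (hz x hx h).1) hx hxz,
      hX.swap.mem_of_star (G := G) (by rw [← edges_swap G]; exact Set.preimage_mono hG) hS hzS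
        (fun x hx h => (hz x hx h).2) hx hxz⟩

variable [DecidableEq V]

/-- Every nonempty set `A` of vertices of `S` other than `w`, which is either a singleton or
consists of vertices that `η` joins to `v`, is joined by `η` to some vertex of `S` outside `A` that
is `w` or that `η` joins to `v`. -/
def Expands (η : Set (V × V)) (S : Finset V) (w v : V) : Prop :=
  ∀ A ⊆ S.erase w, A.Nonempty → ((∀ x ∈ A, (x, v) ∈ η) ∨ A.card = 1) →
    ∃ x ∈ A, ∃ y ∈ S, y ∉ A ∧ (y = w ∨ (y, v) ∈ η) ∧ (x, y) ∈ η

/-- Starting from `(w, v)`, the edges of `η` into `v` fill up, since the set of those missing would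
have an `η`-edge to a vertex already done. The singleton case of `Expands` then reaches the edges of
`ω` outside `η`. -/
lemma SaturatedOn.mem_of_expands (hS : SaturatedOn ω X S) (hX : ClosedUnder ω X) (hη : η ⊆ ω)
    {w v : V} (hv : v ∉ S) (hwv : (w, v) ∈ X) (hexp : Expands η S w v) {x : V} (hx : x ∈ S)
    (hxv : (x, v) ∈ ω) : (x, v) ∈ X := by
  classical
  have hne : ∀ y ∈ S, y ≠ v := fun y hy h => hv (h ▸ hy)
  have h1 : ∀ y ∈ S, (y, v) ∈ η → (y, v) ∈ X := by
    by_contra! hc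
    obtain ⟨y₀, hy₀, h1, h2⟩ := hc
    obtain ⟨x, hx, y, hy, hyA, hyv, hxy⟩ := hexp
      ((S.erase w).filter fun y => (y, v) ∈ η ∧ (y, v) ∉ X) (Finset.filter_subset _ _)
      ⟨y₀, by
        simp only [Finset.mem_filter, Finset.mem_erase]
        exact ⟨⟨fun h => h2 (h ▸ hwv), hy₀⟩, h1, h2⟩⟩
      (Or.inl fun x hx => (Finset.mem_filter.1 hx).2.1)
    obtain ⟨hxS, hxη, hxX⟩ := Finset.mem_filter.1 hx
    have hxS := Finset.mem_of_mem_erase hxS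
    have hyX : (y, v) ∈ X := by
      by_cases hyw : y = w
      · rwa [hyw]
      · by_contra hyX
        exact hyA (Finset.mem_filter.2 ⟨Finset.mem_erase.2 ⟨hyw, hy⟩, hyv.resolve_left hyw, hyX⟩)
    have hxy' : x ≠ y := fun h => hyA (h ▸ hx)
    exact hxX (hX (hne x hxS) (hη hxη) (hS x hxS y hy hxy' (hη hxy)) hyX)
  by_cases hxw : x = w
  · rwa [hxw]
  obtain ⟨x', hx', y, hy, hyA, hyv, hxy⟩ := hexp {x}
    (by simpa using ⟨hxw, hx⟩) (by simp) (Or.inr (by simp))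
  obtain rfl := Finset.mem_singleton.1 hx'
  have hyX : (y, v) ∈ X := hyv.elim (fun h => h ▸ hwv) (h1 y hy)
  exact hX (hne _ hx) hxv (hS _ hx y hy (fun h => hyA (by simp [h])) (hη hxy)) hyX

lemma SaturatedOn.insert (hS : SaturatedOn ω X S) (hX : ClosedUnder ω X) (hη : η ⊆ ω)
    {w v : V} (hv : v ∉ S) (hwv : (w, v) ∈ X) (hvw : (v, w) ∈ X) (hin : Expands η S w v)
    (hout : Expands (Prod.swap ⁻¹' η) S w v) : SaturatedOn ω X (insert v S) := by
  have h1 : ∀ x ∈ S, (x, v) ∈ ω → (x, v) ∈ X :=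
    fun x hx h => hS.mem_of_expands hX hη hv hwv hin hx h
  have h2 : ∀ x ∈ S, (v, x) ∈ ω → (v, x) ∈ X := fun x hx h =>
    hS.swap.mem_of_expands hX.swap (Set.preimage_mono hη) hv (w := w) hvw hout hx h
  intro x hx y hy hxy ho
  rcases Finset.mem_insert.1 hx with rfl | hx' <;> rcases Finset.mem_insert.1 hy with rfl | hy'
  · exact absurd rfl hxy
  · exact h2 y hy' ho
  · exact h1 x hx' ho
  · exact hS x hx' y hy' hxy ho

/-- In a connected graph a nonempty set can be enlarged, vertex by vertex, to the whole graph. -/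
lemma exists_growth [Fintype V] {G : SimpleGraph V} (hG : G.Connected) {A : Finset V}
    (hA : A.Nonempty) : ∃ (S : ℕ → Finset V) (w v : ℕ → V), S 0 = A ∧
      (∀ i, S (i + 1) = insert (v i) (S i)) ∧ ∀ i, A.card + i ≤ Fintype.card V →
        (S i).card = A.card + i ∧ (A.card + i < Fintype.card V →
          w i ∈ S i ∧ v i ∉ S i ∧ G.Adj (w i) (v i)) := by
  have hne : Nonempty V := ⟨hA.choose⟩
  have hstep : ∀ T : Finset V, T.Nonempty ∧ T.card < Fintype.card V →
      ∃ w v, w ∈ T ∧ v ∉ T ∧ G.Adj w v := by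
    rintro T ⟨⟨a, ha⟩, hT⟩
    obtain ⟨b, hb⟩ : ∃ b, b ∉ T := by
      by_contra! hc
      rw [Finset.eq_univ_of_forall hc, Finset.card_univ] at hT
      exact lt_irrefl _ hT
    obtain ⟨q⟩ := hG.preconnected a b
    obtain ⟨d, _, h1, h2⟩ := q.exists_boundary_dart (T : Set V) ha hb
    exact ⟨d.fst, d.snd, h1, h2, d.adj⟩
  choose! w v hwv using hstep
  let S : ℕ → Finset V := fun i => i.rec A fun _ T => insert (v T) T
  refine ⟨S, fun i => w (S i), fun i => v (S i), rfl, fun i => rfl, ?_⟩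
  have hSne : ∀ i, (S i).Nonempty := by
    intro i
    cases i with
    | zero => exact hA
    | succ i => exact Finset.insert_nonempty _ _
  have hcard : ∀ i, A.card + i ≤ Fintype.card V → (S i).card = A.card + i := by
    intro i
    induction i with
    | zero => exact fun _ => rfl
    | succ i ih =>
      intro hi
      have h1 := ih (by omega)
      change (insert (v (S i)) (S i)).card = _
      rw [Finset.card_insert_of_notMem (hwv (S i) ⟨hSne i, by omega⟩).2.1]
      omega
  exact fun i hi => ⟨hcard i hi, fun hi' => hwv (S i) ⟨hSne i, by rw [hcard i hi]; exact hi'⟩⟩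

end Growth

/-! ### Saturation of the closure -/

section Saturation

variable {V : Type*} {E0 Eopen : Set (V × V)}

lemma occupied_mono (t t' : ℕ) (h : t ≤ t') : occupied E0 Eopen t ⊆ occupied E0 Eopen t' := by
  induction t', h using Nat.le_induction with
  | base => exact subset_rfl
  | succ t' _ ih => exact ih.trans Set.subset_union_left

lemma subset_eventuallyOccupied : E0 ⊆ eventuallyOccupied E0 Eopen :=
  Set.subset_iUnion (occupied E0 Eopen) 0

lemma eventuallyOccupied_subset : eventuallyOccupied E0 Eopen ⊆ E0 ∪ Eopen := by
  refine Set.iUnion_subset fun t => ?_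
  induction t with
  | zero => exact Set.subset_union_left
  | succ t ih => exact Set.union_subset ih fun e he => Or.inr he.1

lemma mem_eventuallyOccupied {i j k : V} (ho : (i, j) ∈ Eopen)
    (h1 : (i, k) ∈ eventuallyOccupied E0 Eopen) (h2 : (k, j) ∈ eventuallyOccupied E0 Eopen) :
    (i, j) ∈ eventuallyOccupied E0 Eopen := by
  obtain ⟨s, hs⟩ := Set.mem_iUnion.1 h1
  obtain ⟨t, ht⟩ := Set.mem_iUnion.1 h2
  refine Set.mem_iUnion.2 ⟨max s t + 1, Or.inr ⟨ho, k, ?_, ?_⟩⟩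
  · exact occupied_mono s _ (le_max_left _ _) hs
  · exact occupied_mono t _ (le_max_right _ _) ht

/-- Trimming self-loops and initial edges from `ω` is harmless: `ClosedUnder` ignores the former,
and the latter are occupied from the start. Hence `ω` can be sampled on all pairs. -/
lemma closedUnder_eventuallyOccupied (ω : Set (V × V)) :
    ClosedUnder ω (eventuallyOccupied E0 (ω ∩ {e | e.1 ≠ e.2 ∧ e ∉ E0})) := by
  intro i k j hij ho h1 h2
  by_cases h : (i, j) ∈ E0
  · exact subset_eventuallyOccupied h
  · exact mem_eventuallyOccupied ⟨ho, hij, h⟩ h1 h2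

/-- The set `A` grows to the whole vertex set if each of the successive vertices is absorbed. -/
lemma eventuallyOccupied_eq_of_saturatedOn [Fintype V] [DecidableEq V] {G : SimpleGraph V}
    {ω η : Set (V × V)} (hη : η ⊆ ω) {A : Finset V} {S : ℕ → Finset V} {w v : ℕ → V}
    (hS0 : S 0 = A) (hSs : ∀ i, S (i + 1) = insert (v i) (S i))
    (hS : ∀ i, A.card + i ≤ Fintype.card V → (S i).card = A.card + i ∧
      (A.card + i < Fintype.card V → w i ∈ S i ∧ v i ∉ S i ∧ G.Adj (w i) (v i)))
    (hexp : ∀ i, A.card + i < Fintype.card V → Expands η (S i) (w i) (v i) ∧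
      Expands (Prod.swap ⁻¹' η) (S i) (w i) (v i))
    (hA : SaturatedOn ω (eventuallyOccupied (edges G)
      (ω ∩ {e | e.1 ≠ e.2 ∧ e ∉ edges G})) A) :
    eventuallyOccupied (edges G) (ω ∩ {e | e.1 ≠ e.2 ∧ e ∉ edges G}) =
      edges G ∪ (ω ∩ {e | e.1 ≠ e.2 ∧ e ∉ edges G}) := by
  set X := eventuallyOccupied (edges G) (ω ∩ {e | e.1 ≠ e.2 ∧ e ∉ edges G}) with hX
  have hcl : ClosedUnder ω X := closedUnder_eventuallyOccupied ω
  have hGX : edges G ⊆ X := subset_eventuallyOccupied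
  have hall : ∀ i, A.card + i ≤ Fintype.card V → SaturatedOn ω X (S i) := by
    intro i
    induction i with
    | zero => intro _; rwa [hS0]
    | succ i ih =>
      intro hi
      obtain ⟨_, h⟩ := hS i (by omega)
      obtain ⟨h1, h2, h3⟩ := h (by omega)
      obtain ⟨he1, he2⟩ := hexp i (by omega)
      rw [hSs]
      exact (ih (by omega)).insert hcl hη h2 (hGX h3) (hGX h3.symm) he1 he2
  have hAV : A.card ≤ Fintype.card V := Finset.card_le_univ A
  have hlast := hall (Fintype.card V - A.card) (by omega)
  have huniv : S (Fintype.card V - A.card) = Finset.univ := by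
    rw [← Finset.card_eq_iff_eq_univ, (hS _ (by omega)).1]
    omega
  rw [huniv] at hlast
  refine Set.Subset.antisymm eventuallyOccupied_subset (Set.union_subset hGX ?_)
  rintro ⟨x, y⟩ ⟨h1, h2, _⟩
  exact hlast x (Finset.mem_univ _) y (Finset.mem_univ _) h2 h1

end Saturation

/-! ### Probability that a vertex is absorbed -/

lemma one_sub_pow_le_exp {q : ℝ} (hq1 : q ≤ 1) (j : ℕ) :
    (1 - q) ^ j ≤ Real.exp (-(q * j)) := by
  calc (1 - q) ^ j ≤ Real.exp (-q) ^ j := by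
        have h0 : 0 ≤ 1 - q := by linarith
        gcongr
        exact Real.one_sub_le_exp_neg q
    _ = Real.exp (-(q * j)) := by rw [← Real.exp_nat_mul]; ring_nf

lemma exp_three_tenths : (4 / 3 : ℝ) ≤ Real.exp (3 / 10) := by
  have := Real.quadratic_le_exp_of_nonneg (show (0 : ℝ) ≤ 3 / 10 by norm_num)
  linarith

/-- A lower tail bound for the binomial distribution. -/
lemma sum_powerset_lower_tail_le {V : Type*} (S : Finset V) {q : ℝ} (hq0 : 0 ≤ q) (hq1 : q ≤ 1) :
    ∑ N ∈ S.powerset with (N.card : ℝ) < 3 / 4 * (q * S.card),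
      q ^ N.card * (1 - q) ^ (S.card - N.card) ≤ Real.exp (-(q * S.card / 40)) := by
  set m₀ : ℝ := 3 / 4 * (q * S.card) with hm
  have hq1' : 0 ≤ 1 - q := by linarith
  calc _ ≤ ∑ N ∈ S.powerset with (N.card : ℝ) < m₀,
          Real.exp (3 / 10 * m₀) * ((3 / 4 * q) ^ N.card * (1 - q) ^ (S.card - N.card)) := by
        refine Finset.sum_le_sum fun N hN => ?_
        have hN' := (Finset.mem_filter.1 hN).2
        -- Exponential Markov inequality: this weight is at least `1` on the tail, and summing it
        -- over all `N` gives exponent `9 / 40 - 1 / 4 = -1 / 40` times `q * S.card`.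
        have h1 : 1 ≤ Real.exp (3 / 10 * m₀) * (3 / 4) ^ N.card := by
          have h2 : Real.exp (-(3 / 10)) ≤ 3 / 4 := by
            rw [Real.exp_neg, inv_le_comm₀ (Real.exp_pos _) (by norm_num)]
            exact le_trans (by norm_num) exp_three_tenths
          calc (1 : ℝ) ≤ Real.exp (3 / 10 * m₀) * Real.exp (-(3 / 10)) ^ N.card := by
                rw [← Real.exp_nat_mul, ← Real.exp_add]
                exact Real.one_le_exp (by linarith)
            _ ≤ _ := by gcongr
        rw [mul_pow]
        calc q ^ N.card * (1 - q) ^ (S.card - N.card)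
            = 1 * (q ^ N.card * (1 - q) ^ (S.card - N.card)) := (one_mul _).symm
          _ ≤ (Real.exp (3 / 10 * m₀) * (3 / 4) ^ N.card) *
                (q ^ N.card * (1 - q) ^ (S.card - N.card)) := by gcongr
          _ = _ := by ring
    _ ≤ ∑ N ∈ S.powerset,
          Real.exp (3 / 10 * m₀) * ((3 / 4 * q) ^ N.card * (1 - q) ^ (S.card - N.card)) :=
        Finset.sum_le_sum_of_subset_of_nonneg (Finset.filter_subset _ _)
          fun _ _ _ => by positivity
    _ = Real.exp (3 / 10 * m₀) * (1 - q / 4) ^ S.card := by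
        rw [← Finset.mul_sum, Finset.sum_pow_mul_eq_add_pow]
        ring_nf
    _ ≤ Real.exp (3 / 10 * m₀) * Real.exp (-(q / 4 * S.card)) := by
        gcongr
        exact one_sub_pow_le_exp (by linarith) _
    _ ≤ _ := by
        rw [← Real.exp_add]
        apply Real.exp_le_exp.2
        rw [hm]
        linarith

/-- Let `b` be the smaller side of the cut. The other side has at least `(m + 1) / 2` vertices and
the binomial coefficient is at most `(m + 1) ^ b`, so the term is at most the `b`-th power of the
right-hand side, which is at most `1`. -/
lemma choose_mul_pow_le {q : ℝ} (hq0 : 0 ≤ q) (hq1 : q ≤ 1) {m a : ℕ} (ha : 1 ≤ a) (ham : a ≤ m)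
    (hy : (m + 1) * Real.exp (-(q * (m + 1) / 2)) ≤ 1) :
    (m.choose a) * (1 - q) ^ (a * (m + 1 - a)) ≤ (m + 1) * Real.exp (-(q * (m + 1) / 2)) := by
  have key : ∀ b c : ℕ, 1 ≤ b → b + c = m + 1 → b ≤ c → (m.choose a : ℝ) ≤ ((m : ℝ) + 1) ^ b →
      a * (m + 1 - a) = b * c → (m.choose a) * (1 - q) ^ (a * (m + 1 - a)) ≤
        (m + 1) * Real.exp (-(q * (m + 1) / 2)) := by
    intro b c hb hbc hle hch hmul
    have hbc' : (b : ℝ) + c = m + 1 := by exact_mod_cast hbc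
    have hle' : (b : ℝ) ≤ c := by exact_mod_cast hle
    calc (m.choose a) * (1 - q) ^ (a * (m + 1 - a))
        ≤ ((m : ℝ) + 1) ^ b * Real.exp (-(q * (m + 1) / 2)) ^ b := by
          gcongr
          rw [hmul, ← Real.exp_nat_mul]
          refine (one_sub_pow_le_exp hq1 _).trans (Real.exp_le_exp.2 ?_)
          push_cast
          have : 0 ≤ q * b * (c - (m + 1) / 2) := mul_nonneg (by positivity) (by linarith)
          nlinarith
      _ = ((m + 1) * Real.exp (-(q * (m + 1) / 2))) ^ b := (mul_pow _ _ _).symm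
      _ ≤ _ := pow_le_of_le_one (by positivity) hy (by omega)
  have hm1 : (m : ℝ) ≤ m + 1 := by linarith
  by_cases h : 2 * a ≤ m + 1
  · refine key a (m + 1 - a) ha (by omega) (by omega) ?_ rfl
    calc (m.choose a : ℝ) ≤ (m : ℝ) ^ a := by exact_mod_cast Nat.choose_le_pow m a
      _ ≤ _ := by gcongr
  · refine key (m + 1 - a) a (by omega) (by omega) (by omega) ?_ (mul_comm _ _)
    calc (m.choose a : ℝ) = m.choose (m - a) := by rw [Nat.choose_symm ham]
      _ ≤ (m : ℝ) ^ (m - a) := by exact_mod_cast Nat.choose_le_pow m (m - a)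
      _ ≤ ((m : ℝ) + 1) ^ (m - a) := by gcongr
      _ ≤ _ := by
        refine pow_le_pow_right₀ (by linarith [(Nat.cast_nonneg m : (0 : ℝ) ≤ m)]) (by omega)

lemma sum_powerset_cut_le {V : Type*} [DecidableEq V] (N : Finset V) {q : ℝ} (hq0 : 0 ≤ q)
    (hq1 : q ≤ 1) (hy : (N.card + 1) * Real.exp (-(q * (N.card + 1) / 2)) ≤ 1) :
    ∑ A ∈ N.powerset.erase ∅, (1 - q) ^ (A.card * (N.card + 1 - A.card)) ≤
      N.card * ((N.card + 1) * Real.exp (-(q * (N.card + 1) / 2))) := by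
  set m := N.card with hm
  let f : ℕ → ℝ := fun a => if a = 0 then 0 else (1 - q) ^ (a * (m + 1 - a))
  calc ∑ A ∈ N.powerset.erase ∅, (1 - q) ^ (A.card * (m + 1 - A.card))
      = ∑ A ∈ N.powerset, f A.card := by
        rw [← Finset.sum_erase_add N.powerset _ (Finset.empty_mem_powerset N)]
        simp only [Finset.card_empty, f, if_true, add_zero]
        refine Finset.sum_congr rfl fun A hA => ?_
        rw [if_neg]
        exact Finset.card_ne_zero.2 (Finset.nonempty_iff_ne_empty.2 (Finset.mem_erase.1 hA).1)
    _ = ∑ a ∈ Finset.range (m + 1), (m.choose a) • f a := Finset.sum_powerset_apply_card f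
    _ = ∑ a ∈ Finset.range m, (m.choose (a + 1)) • f (a + 1) := by
        rw [Finset.sum_range_succ']
        simp [f]
    _ ≤ ∑ _a ∈ Finset.range m, (m + 1) * Real.exp (-(q * (m + 1) / 2)) := by
        refine Finset.sum_le_sum fun a ha => ?_
        rw [nsmul_eq_mul]
        simp only [f, Nat.succ_ne_zero, if_false]
        exact choose_mul_pow_le hq0 hq1 (by omega) (by simpa using ha) hy
    _ = _ := by simp

/-- Split according to the set `N` of `η`-neighbours of `v` in `S`. Either `N` is smaller than `3 /
4` of its mean, or some cut of `insert w N`, or some single vertex, has no outgoing edge. Edges into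
`v` are disjoint from edges within `S`, so the probabilities multiply. -/
lemma setBernoulli_univ_real_not_expands_le {V : Type*} [Finite V] [DecidableEq V] (q : I)
    {S : Finset V} {w v : V} (hw : w ∈ S) (hv : v ∉ S) {t : ℕ} (ht : S.card = t + 1) :
    (setBernoulli (Set.univ : Set (V × V)) q).real {η | ¬ Expands η S w v} ≤
      Real.exp (-(q * t / 40)) + (t + 1) ^ 2 * Real.exp (-(3 / 8 * (q : ℝ) ^ 2 * t)) := by
  classical
  set μ := setBernoulli (Set.univ : Set (V × V)) q with hμ
  have hq0 : (0 : ℝ) ≤ q := q.2.1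
  have hq1 : (q : ℝ) ≤ 1 := q.2.2
  have hq1' : (0 : ℝ) ≤ 1 - q := by linarith
  set ε : ℝ := Real.exp (-(3 / 8 * (q : ℝ) ^ 2 * t)) with hε
  -- A bound above `1` is trivial; otherwise the smallness hypothesis of `sum_powerset_cut_le`
  -- follows.
  by_cases hbig : 1 < (t + 1) ^ 2 * ε
  · have h1 : μ.real {η | ¬ Expands η S w v} ≤ 1 := measureReal_le_one
    have := Real.exp_pos (-(q * t / 40 : ℝ))
    linarith
  push Not at hbig
  set S' := S.erase w with hS'
  have hS'c : S'.card = t := by rw [hS', Finset.card_erase_of_mem hw, ht]; rfl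
  have hvS' : v ∉ S' := fun h => hv (Finset.mem_of_mem_erase h)
  set m₀ : ℝ := 3 / 4 * (q * S'.card) with hm₀
  let W : Finset V → Finset V → ℝ := fun N A =>
    (1 - q : ℝ) ^ (A.card * ((insert w N) \ A).card)
  let U : Finset V → Finset V → Finset (V × V) := fun N A =>
    (S' \ N).image (fun x => (x, v)) ∪ A ×ˢ ((insert w N) \ A)
  let B : Finset V → Finset V → Set (Set (V × V)) := fun N A =>
    {η | (∀ i ∈ N.image (fun x => (x, v)), i ∈ η) ∧ ∀ i ∈ U N A, i ∉ η}
  have hinj : Function.Injective (fun x : V => (x, v)) := fun x y h => (Prod.ext_iff.1 h).1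
  have hB : ∀ N ⊆ S', ∀ A, μ.real (B N A) =
      (q : ℝ) ^ N.card * (1 - q : ℝ) ^ (S'.card - N.card) * W N A := by
    intro N hN A
    have hvN : v ∉ insert w N := by
      intro h
      rcases Finset.mem_insert.1 h with h | h
      · exact hv (h ▸ hw)
      · exact hvS' (hN h)
    have hd1 : Disjoint (N.image (fun x => (x, v))) (U N A) := by
      rw [Finset.disjoint_left]
      rintro _ hi hU
      obtain ⟨x, hx, rfl⟩ := Finset.mem_image.1 hi
      rcases Finset.mem_union.1 hU with h | h
      · obtain ⟨y, hy, hxy⟩ := Finset.mem_image.1 h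
        rw [hinj hxy] at hy
        exact (Finset.mem_sdiff.1 hy).2 hx
      · exact hvN (Finset.mem_sdiff.1 (Finset.mem_product.1 h).2).1
    have hd2 : Disjoint ((S' \ N).image (fun x => (x, v))) (A ×ˢ ((insert w N) \ A)) := by
      rw [Finset.disjoint_left]
      rintro _ hi h
      obtain ⟨x, hx, rfl⟩ := Finset.mem_image.1 hi
      exact hvN (Finset.mem_sdiff.1 (Finset.mem_product.1 h).2).1
    rw [hμ, setBernoulli_univ_real_cylinder q hd1, Finset.card_union_of_disjoint hd2,
      Finset.card_image_of_injective _ hinj, Finset.card_image_of_injective _ hinj,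
      Finset.card_product, Finset.card_sdiff_of_subset hN, pow_add, mul_assoc]
  have hsub : {η | ¬ Expands η S w v} ⊆
      (⋃ N ∈ S'.powerset.filter (fun N => (N.card : ℝ) < m₀), B N ∅) ∪
      ⋃ N ∈ S'.powerset.filter (fun N => ¬ (N.card : ℝ) < m₀),
        ((⋃ A ∈ N.powerset.erase ∅, B N A) ∪ ⋃ x ∈ S', B N {x}) := by
    intro η hη
    simp only [Set.mem_ofPred_eq, Expands, not_forall] at hη
    obtain ⟨A, hAS, hA, hA', hno⟩ := hη
    push Not at hno
    set N := S'.filter fun x => (x, v) ∈ η with hN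
    have hNS : N ⊆ S' := Finset.filter_subset _ _
    have hmem : ∀ A' : Finset V, (∀ x ∈ A', ∀ y ∈ insert w N, y ∉ A' → (x, y) ∉ η) →
        η ∈ B N A' := by
      intro A' h
      refine ⟨fun i hi => ?_, fun i hi => ?_⟩
      · obtain ⟨x, hx, rfl⟩ := Finset.mem_image.1 hi
        exact (Finset.mem_filter.1 hx).2
      · rcases Finset.mem_union.1 hi with hi | hi
        · obtain ⟨x, hx, rfl⟩ := Finset.mem_image.1 hi
          obtain ⟨hx1, hx2⟩ := Finset.mem_sdiff.1 hx
          exact fun h => hx2 (Finset.mem_filter.2 ⟨hx1, h⟩)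
        · obtain ⟨h1, h2⟩ := Finset.mem_product.1 hi
          obtain ⟨h2, h3⟩ := Finset.mem_sdiff.1 h2
          exact h _ h1 _ h2 h3
    by_cases hsmall : (N.card : ℝ) < m₀
    · left
      rw [Set.mem_iUnion₂]
      -- With `A = ∅` the event `B N A` only prescribes the neighbourhood `N`.
      exact ⟨N, Finset.mem_filter.2 ⟨Finset.mem_powerset.2 hNS, hsmall⟩, hmem ∅ (by simp)⟩
    · right
      rw [Set.mem_iUnion₂]
      refine ⟨N, Finset.mem_filter.2 ⟨Finset.mem_powerset.2 hNS, hsmall⟩, ?_⟩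
      have hBA : η ∈ B N A := by
        refine hmem A fun x hx y hy hyA => ?_
        rcases Finset.mem_insert.1 hy with rfl | hy
        · exact hno x hx _ hw hyA (Or.inl rfl)
        · obtain ⟨h1, h2⟩ := Finset.mem_filter.1 hy
          exact hno x hx y (Finset.mem_of_mem_erase h1) hyA (Or.inr h2)
      rcases hA' with hA' | hA'
      · left
        rw [Set.mem_iUnion₂]
        refine ⟨A, Finset.mem_erase.2 ⟨hA.ne_empty, Finset.mem_powerset.2 fun x hx => ?_⟩, hBA⟩
        exact Finset.mem_filter.2 ⟨hAS hx, hA' x hx⟩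
      · right
        obtain ⟨x, rfl⟩ := Finset.card_eq_one.1 hA'
        rw [Set.mem_iUnion₂]
        exact ⟨x, hAS (by simp), hBA⟩
  have hlarge : ∀ N ∈ S'.powerset.filter (fun N => ¬ (N.card : ℝ) < m₀),
      μ.real ((⋃ A ∈ N.powerset.erase ∅, B N A) ∪ ⋃ x ∈ S', B N {x}) ≤
        (q : ℝ) ^ N.card * (1 - q : ℝ) ^ (S'.card - N.card) * ((t + 1) ^ 2 * ε) := by
    intro N hN
    obtain ⟨hNS, hNm⟩ := Finset.mem_filter.1 hN
    rw [Finset.mem_powerset] at hNS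
    push Not at hNm
    have hwN : w ∉ N := fun h => Finset.notMem_erase w S (hNS h)
    have hNt : (N.card : ℝ) ≤ t := by exact_mod_cast (Finset.card_le_card hNS).trans_eq hS'c
    have hexp1 : Real.exp (-(q * (N.card + 1) / 2 : ℝ)) ≤ ε := by
      apply Real.exp_le_exp.2
      have : (q : ℝ) * m₀ ≤ q * (N.card + 1) := by gcongr; linarith
      rw [hm₀, hS'c] at this
      nlinarith
    have hε0 : 0 < ε := Real.exp_pos _
    have hy : (N.card + 1) * Real.exp (-(q * (N.card + 1) / 2 : ℝ)) ≤ 1 := by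
      refine le_trans ?_ hbig
      gcongr
      nlinarith
    have hc1 : ∑ A ∈ N.powerset.erase ∅, W N A ≤ t * ((t + 1) * ε) := by
      have h1 := sum_powerset_cut_le N hq0 hq1 hy
      have h2 : ∑ A ∈ N.powerset.erase ∅, W N A =
          ∑ A ∈ N.powerset.erase ∅, (1 - q : ℝ) ^ (A.card * (N.card + 1 - A.card)) := by
        refine Finset.sum_congr rfl fun A hA => ?_
        have hAN := Finset.mem_powerset.1 (Finset.mem_erase.1 hA).2
        simp only [W]
        rw [Finset.card_sdiff_of_subset (hAN.trans (Finset.subset_insert _ _)),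
          Finset.card_insert_of_notMem hwN]
      rw [h2]
      refine h1.trans ?_
      gcongr
    have hc2 : ∑ x ∈ S', W N {x} ≤ t * ε := by
      have h1 : ∀ x ∈ S', W N {x} ≤ ε := by
        intro x _
        have h2 : N.card ≤ ((insert w N) \ {x}).card := by
          have := Finset.le_card_sdiff {x} (insert w N)
          rw [Finset.card_insert_of_notMem hwN, Finset.card_singleton] at this
          omega
        simp only [W, Finset.card_singleton, one_mul]
        refine (pow_le_pow_of_le_one hq1' (by linarith) h2).trans
          ((one_sub_pow_le_exp hq1 _).trans (Real.exp_le_exp.2 ?_))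
        have h3 : (q : ℝ) * m₀ ≤ q * N.card := by gcongr
        rw [hm₀, hS'c] at h3
        have h4 : 0 ≤ (q : ℝ) ^ 2 * t := by positivity
        nlinarith
      have := Finset.sum_le_card_nsmul S' _ _ h1
      rwa [hS'c, nsmul_eq_mul] at this
    calc μ.real ((⋃ A ∈ N.powerset.erase ∅, B N A) ∪ ⋃ x ∈ S', B N {x})
        ≤ ∑ A ∈ N.powerset.erase ∅, μ.real (B N A) + ∑ x ∈ S', μ.real (B N {x}) :=
          (measureReal_union_le _ _).trans (add_le_add (measureReal_biUnion_finset_le _ _)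
            (measureReal_biUnion_finset_le _ _))
      _ = (q : ℝ) ^ N.card * (1 - q : ℝ) ^ (S'.card - N.card) *
          (∑ A ∈ N.powerset.erase ∅, W N A + ∑ x ∈ S', W N {x}) := by
          simp only [hB N hNS, ← Finset.mul_sum, mul_add]
      _ ≤ _ := by
          gcongr
          have ht0 : (0 : ℝ) ≤ t := by positivity
          nlinarith
  calc μ.real {η | ¬ Expands η S w v}
      ≤ ∑ N ∈ S'.powerset with (N.card : ℝ) < m₀, μ.real (B N ∅) +
        ∑ N ∈ S'.powerset with ¬ (N.card : ℝ) < m₀,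
          μ.real ((⋃ A ∈ N.powerset.erase ∅, B N A) ∪ ⋃ x ∈ S', B N {x}) :=
        (measureReal_mono hsub (measure_ne_top _ _)).trans ((measureReal_union_le _ _).trans
          (add_le_add (measureReal_biUnion_finset_le _ _) (measureReal_biUnion_finset_le _ _)))
    _ ≤ Real.exp (-(q * t / 40)) + ∑ N ∈ S'.powerset,
          (q : ℝ) ^ N.card * (1 - q : ℝ) ^ (S'.card - N.card) * ((t + 1) ^ 2 * ε) := by
        refine add_le_add ?_ ((Finset.sum_le_sum hlarge).trans ?_)
        · have h := sum_powerset_lower_tail_le S' hq0 hq1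
          rw [← hm₀] at h
          rw [hS'c] at h
          refine le_trans (le_of_eq (Finset.sum_congr rfl fun N hN => ?_)) h
          rw [hB N (Finset.mem_powerset.1 (Finset.mem_filter.1 hN).1)]
          simp [W, hS'c]
        · refine Finset.sum_le_sum_of_subset_of_nonneg (Finset.filter_subset _ _)
            fun N _ _ => ?_
          have : 0 < ε := Real.exp_pos _
          positivity
    _ = _ := by
        rw [← Finset.sum_mul, Finset.sum_pow_mul_eq_add_pow]
        simp

/-! ### Probability of saturation -/

lemma map_swap_setBernoulli_univ {V : Type*} [Finite V] (p : I) :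
    (setBernoulli (Set.univ : Set (V × V)) p).map (fun η => Prod.swap ⁻¹' η) =
      setBernoulli (Set.univ : Set (V × V)) p := by
  classical
  have hm : Measurable (fun η : Set (V × V) => Prod.swap ⁻¹' η) := measurable_of_countable _
  have : IsProbabilityMeasure ((setBernoulli (Set.univ : Set (V × V)) p).map
      (fun η => Prod.swap ⁻¹' η)) := Measure.isProbabilityMeasure_map hm.aemeasurable
  refine measure_set_ext_avoid fun U => ?_
  rw [Measure.map_apply hm MeasurableSet.of_discrete]
  have h : (fun η : Set (V × V) => Prod.swap ⁻¹' η) ⁻¹' {ω | ∀ i ∈ U, i ∉ ω} =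
      {ω | ∀ i ∈ U.image Prod.swap, i ∉ ω} := by
    ext ω
    simp only [Set.mem_preimage, Set.mem_ofPred_eq, Finset.forall_mem_image]
  rw [h, ← ENNReal.toReal_eq_toReal_iff' (by simp) (by simp), ← measureReal_def, ← measureReal_def,
    setBernoulli_real_avoid, setBernoulli_real_avoid]
  simp [Finset.card_image_of_injective _ Prod.swap_injective]

/-- Conditioning on the first sprinkle: `N` is the failure of nucleation, and `δ` bounds the failure
of growth given a nucleus. -/
lemma prod_real_le_add {Ω Ω' : Type*} [MeasurableSpace Ω] [MeasurableSpace Ω']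
    [DiscreteMeasurableSpace Ω] [DiscreteMeasurableSpace (Ω × Ω')]
    (μ : Measure Ω) (ν : Measure Ω') [IsProbabilityMeasure μ] [IsProbabilityMeasure ν]
    (B : Set (Ω × Ω')) (N : Set Ω) {δ : ℝ} (hδ : 0 ≤ δ)
    (h : ∀ ω ∉ N, ν.real {ω' | (ω, ω') ∈ B} ≤ δ) : (μ.prod ν).real B ≤ μ.real N + δ := by
  have h1 : (μ.prod ν) B ≤ μ N + ENNReal.ofReal δ := by
    rw [Measure.prod_apply MeasurableSet.of_discrete]
    calc ∫⁻ ω, ν (Prod.mk ω ⁻¹' B) ∂μ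
        ≤ ∫⁻ ω, (N.indicator 1 ω + ENNReal.ofReal δ) ∂μ := by
          refine lintegral_mono fun ω => ?_
          by_cases hω : ω ∈ N
          · simp only [Set.indicator_of_mem hω, Pi.one_apply]
            exact prob_le_one.trans le_self_add
          · simp only [Set.indicator_of_notMem hω, zero_add]
            exact (ENNReal.le_ofReal_iff_toReal_le (measure_ne_top _ _) hδ).2 (h ω hω)
      _ = _ := by
          rw [lintegral_add_right _ measurable_const, lintegral_indicator_one
            MeasurableSet.of_discrete]
          simp
  rw [measureReal_def, measureReal_def]
  refine (ENNReal.toReal_mono (by simp) h1).trans ?_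
  rw [ENNReal.toReal_add (by simp) (by simp), ENNReal.toReal_ofReal hδ]

section Saturation

variable {V : Type*} [Fintype V]

/-- The bound for the probability that a vertex is not absorbed by a set of size `t + 1`. -/
noncomputable def absorbBound (q : ℝ) (t : ℕ) : ℝ :=
  Real.exp (-(q * t / 40)) + (t + 1) ^ 2 * Real.exp (-(3 / 8 * q ^ 2 * t))

lemma absorbBound_nonneg (q : ℝ) (t : ℕ) : 0 ≤ absorbBound q t := by
  unfold absorbBound; positivity

lemma setBernoulli_univ_real_not_growth_le [DecidableEq V] (q : I) {k : ℕ} {A : Finset V}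
    (hA : A.card = k + 1) {G : SimpleGraph V} {S : ℕ → Finset V} {w v : ℕ → V}
    (hS : ∀ i, A.card + i ≤ Fintype.card V → (S i).card = A.card + i ∧
      (A.card + i < Fintype.card V → w i ∈ S i ∧ v i ∉ S i ∧ G.Adj (w i) (v i))) :
    (setBernoulli (Set.univ : Set (V × V)) q).real
      {η | ¬ ∀ i, A.card + i < Fintype.card V → Expands η (S i) (w i) (v i) ∧
        Expands (Prod.swap ⁻¹' η) (S i) (w i) (v i)} ≤
      ∑ t ∈ Finset.Ico k (Fintype.card V), 2 * absorbBound q t := by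
  set μ := setBernoulli (Set.univ : Set (V × V)) q with hμ
  let E : ℕ → Set (Set (V × V)) := fun t => {η | ¬ Expands η (S (t - k)) (w (t - k)) (v (t - k))} ∪
    {η | ¬ Expands (Prod.swap ⁻¹' η) (S (t - k)) (w (t - k)) (v (t - k))}
  have hsub : {η | ¬ ∀ i, A.card + i < Fintype.card V → Expands η (S i) (w i) (v i) ∧
      Expands (Prod.swap ⁻¹' η) (S i) (w i) (v i)} ⊆
      ⋃ t ∈ (Finset.Ico k (Fintype.card V)).filter (fun t => t + 1 < Fintype.card V), E t := by
    intro η hη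
    simp only [Set.mem_ofPred_eq, not_forall] at hη
    obtain ⟨i, hi, h⟩ := hη
    rw [Set.mem_iUnion₂]
    refine ⟨k + i, by simp; omega, ?_⟩
    simp only [E, add_tsub_cancel_left]
    rw [not_and_or] at h
    exact h
  refine (measureReal_mono hsub (measure_ne_top _ _)).trans
    ((measureReal_biUnion_finset_le _ _).trans ?_)
  refine (Finset.sum_le_sum fun t ht => ?_).trans (Finset.sum_le_sum_of_subset_of_nonneg
    (Finset.filter_subset _ _) fun t _ _ => mul_nonneg zero_le_two (absorbBound_nonneg _ _))
  simp only [Finset.mem_filter, Finset.mem_Ico] at ht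
  obtain ⟨h1, h2⟩ := hS (t - k) (by omega)
  obtain ⟨h3, h4, _⟩ := h2 (by omega)
  have hb := setBernoulli_univ_real_not_expands_le q h3 h4 (t := t) (by omega)
  have hb' : μ.real {η | ¬ Expands (Prod.swap ⁻¹' η) (S (t - k)) (w (t - k)) (v (t - k))} =
      μ.real {η | ¬ Expands η (S (t - k)) (w (t - k)) (v (t - k))} := by
    conv_rhs => rw [hμ, ← map_swap_setBernoulli_univ]
    rw [map_measureReal_apply (measurable_of_countable _) MeasurableSet.of_discrete]
    rfl
  refine (measureReal_union_le _ _).trans ?_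
  rw [hb', two_mul]
  exact add_le_add hb hb

/-- Saturation of a set of `k + 1` vertices spreads, with high probability, to the whole graph. -/
lemma setBernoulli_univ_real_not_saturated_le [DecidableEq V] {G : SimpleGraph V}
    (hG : G.Connected) (q : I) {k : ℕ} {A : Finset V} (hA : A.card = k + 1) (ω : Set (V × V))
    (hω : ∀ η : Set (V × V), SaturatedOn (ω ∪ η) (eventuallyOccupied (edges G)
      ((ω ∪ η) ∩ {e | e.1 ≠ e.2 ∧ e ∉ edges G})) A) :
    (setBernoulli (Set.univ : Set (V × V)) q).real
      {η | eventuallyOccupied (edges G) ((ω ∪ η) ∩ {e | e.1 ≠ e.2 ∧ e ∉ edges G}) ≠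
        edges G ∪ ((ω ∪ η) ∩ {e | e.1 ≠ e.2 ∧ e ∉ edges G})} ≤
      ∑ t ∈ Finset.Ico k (Fintype.card V), 2 * absorbBound q t := by
  -- The order of growth depends only on `G` and `A`, not on `η`, so a union bound over fixed sets
  -- suffices although the steps are dependent.
  obtain ⟨S, w, v, hS0, hSs, hS⟩ := exists_growth hG (A := A) (Finset.card_pos.1 (by omega))
  refine (measureReal_mono (fun η hη => ?_) (measure_ne_top _ _)).trans
    (setBernoulli_univ_real_not_growth_le q hA hS)
  intro hexp
  exact hη (eventuallyOccupied_eq_of_saturatedOn Set.subset_union_right hS0 hSs hS hexp (hω η))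

/-- The first term bounds the probability that none of the disjoint connected `(k + 1)`-sets has an
open double star of at most `2 * k` edges; the sum bounds the failure of growth. -/
lemma openLaw_real_not_saturated_le {G : SimpleGraph V} (hG : G.Connected) {p p₁ q : I}
    (hp : (1 - p : ℝ) = (1 - p₁) * (1 - q)) {k : ℕ} (hk : k + 1 ≤ Fintype.card V) :
    (openLaw (edges G) p).real
      {Eopen | eventuallyOccupied (edges G) Eopen ≠ edges G ∪ Eopen} ≤
      Real.exp (-((p₁ : ℝ) ^ (2 * k) * (Fintype.card V / ((k + 1) * (1 + k * (k + 1)))))) +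
        ∑ t ∈ Finset.Ico k (Fintype.card V), 2 * absorbBound q t := by
  classical
  set δ := ∑ t ∈ Finset.Ico k (Fintype.card V), 2 * absorbBound q t with hδ
  have hδ0 : 0 ≤ δ := Finset.sum_nonneg fun t _ => mul_nonneg zero_le_two (absorbBound_nonneg _ _)
  rw [openLaw, setBernoulli_eq_map_union _ hp,
    map_measureReal_apply (measurable_of_countable _) MeasurableSet.of_discrete]
  by_cases hdeg : ∀ v, (G.neighborSet v).ncard ≤ k
  · obtain ⟨F, hF1, hF2, hF3⟩ := exists_disjoint_preconnected hG hdeg (by omega) hk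
    have hne : ∀ A : F, ∃ z, z ∈ A.1 := fun A =>
      Finset.card_pos.1 (by rw [(hF1 A A.2).1]; omega)
    choose z hz using hne
    let T : F → Finset (V × V) := fun A =>
      (A.1.erase (z A)).image (fun x => (z A, x)) ∪ (A.1.erase (z A)).image (fun x => (x, z A))
    have hTA : ∀ A : F, ∀ e ∈ T A, e.1 ∈ A.1 := by
      intro A e he
      rcases Finset.mem_union.1 he with he | he
      · obtain ⟨x, _, rfl⟩ := Finset.mem_image.1 he
        exact hz A
      · obtain ⟨x, hx, rfl⟩ := Finset.mem_image.1 he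
        exact Finset.mem_of_mem_erase hx
    have hTd : Pairwise fun A B => Disjoint (T A) (T B) := by
      intro A B hAB
      rw [Finset.disjoint_left]
      intro e heA heB
      exact Finset.disjoint_left.1 (hF2 A.2 B.2 (fun h => hAB (Subtype.ext h))) (hTA A e heA)
        (hTA B e heB)
    have hTc : ∀ A, (T A).card ≤ 2 * k := by
      intro A
      have h1 : (A.1.erase (z A)).card = k := by
        rw [Finset.card_erase_of_mem (hz A), (hF1 A A.2).1]; rfl
      refine (Finset.card_union_le _ _).trans ?_
      have h2 := Finset.card_image_le (s := A.1.erase (z A)) (f := fun x => (z A, x))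
      have h3 := Finset.card_image_le (s := A.1.erase (z A)) (f := fun x => (x, z A))
      omega
    refine (prod_real_le_add _ _ _ {ω | ∀ A, ¬ ∀ i ∈ T A, i ∈ ω} hδ0 fun ω hω => ?_).trans ?_
    · obtain ⟨A, hA⟩ : ∃ A, ∀ i ∈ T A, i ∈ ω := by
        by_contra h
        exact hω (not_exists.1 h)
      refine setBernoulli_univ_real_not_saturated_le hG q (hF1 A A.2).1 ω fun η => ?_
      refine saturatedOn_of_open_star (closedUnder_eventuallyOccupied _) subset_eventuallyOccupied
        (hF1 A A.2).2 (hz A) fun x hx hxz => ⟨Or.inl (hA _ ?_), Or.inl (hA _ ?_)⟩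
      · exact Finset.mem_union_left _ (Finset.mem_image_of_mem _ (Finset.mem_erase.2 ⟨hxz, hx⟩))
      · exact Finset.mem_union_right _ (Finset.mem_image_of_mem (fun x => (x, z A))
          (Finset.mem_erase.2 ⟨hxz, hx⟩))
    · gcongr
      rw [setBernoulli_univ_real_none p₁ T hTd]
      have hp0 := p₁.2.1
      have hp1 := p₁.2.2
      calc ∏ A, (1 - (p₁ : ℝ) ^ (T A).card) ≤ ∏ _A : F, Real.exp (-((p₁ : ℝ) ^ (2 * k))) := by
            refine Finset.prod_le_prod (fun A _ => ?_) fun A _ => ?_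
            · linarith [pow_le_one₀ (n := (T A).card) hp0 hp1]
            · have := pow_le_pow_of_le_one hp0 hp1 (hTc A)
              refine le_trans ?_ (Real.one_sub_le_exp_neg _)
              linarith
        _ = Real.exp (-((p₁ : ℝ) ^ (2 * k) * F.card)) := by
            rw [Finset.prod_const, ← Real.exp_nat_mul, Finset.card_univ, Fintype.card_coe]
            ring_nf
        _ ≤ _ := by
            apply Real.exp_le_exp.2
            have : (Fintype.card V / ((k + 1) * (1 + k * (k + 1))) : ℝ) ≤ F.card := by
              rw [div_le_iff₀ (by positivity)]
              exact_mod_cast hF3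
            gcongr
  · push Not at hdeg
    obtain ⟨z, hz⟩ := hdeg
    obtain ⟨B, hB1, hB2⟩ := Finset.exists_subset_card_eq (s := G.neighborFinset z) (n := k) (by
      rw [← Set.ncard_coe_finset, SimpleGraph.coe_neighborFinset]
      exact hz.le)
    have hzB : z ∉ B := fun h => G.irrefl ((G.mem_neighborFinset z z).1 (hB1 h))
    -- Here `z` with `k` of its neighbours is a nucleus made of initial edges, so no `ω` is bad.
    refine (prod_real_le_add _ _ _ ∅ hδ0 fun ω _ => ?_).trans ?_
    · refine setBernoulli_univ_real_not_saturated_le hG q (A := insert z B)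
        (by rw [Finset.card_insert_of_notMem hzB, hB2]) ω fun η => ?_
      refine saturatedOn_of_star (closedUnder_eventuallyOccupied _) (z := z) fun x hx hxz => ?_
      have hadj : G.Adj z x :=
        (G.mem_neighborFinset z x).1 (hB1 ((Finset.mem_insert.1 hx).resolve_left hxz))
      exact ⟨subset_eventuallyOccupied hadj, subset_eventuallyOccupied hadj.symm⟩
    · rw [measureReal_empty]
      gcongr
      positivity

end Saturation

/-! ### Asymptotics in the supercritical regime -/

lemma sum_exp_neg_mul_le {l : ℝ} (hl0 : 0 < l) (hl1 : l ≤ 1) (k n : ℕ) :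
    ∑ t ∈ Finset.Ico k n, Real.exp (-(l * t)) ≤ 2 / l * Real.exp (-(l * k)) := by
  have hpow : ∀ t : ℕ, Real.exp (-(l * t)) = Real.exp (-l) ^ t := fun t => by
    rw [← Real.exp_nat_mul]; ring_nf
  simp only [hpow]
  have hlt : Real.exp (-l) < 1 := by simpa using hl0
  have hgap : l / 2 ≤ 1 - Real.exp (-l) := by
    have h1 : Real.exp (-l) ≤ (1 + l)⁻¹ := by
      rw [Real.exp_neg]
      gcongr
      linarith [Real.add_one_le_exp l]
    have h2 : (1 + l)⁻¹ ≤ 1 - l / 2 := by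
      rw [inv_le_iff_one_le_mul₀ (by linarith)]
      nlinarith
    linarith
  calc ∑ t ∈ Finset.Ico k n, Real.exp (-l) ^ t
      ≤ Real.exp (-l) ^ k / (1 - Real.exp (-l)) :=
        geom_sum_Ico_le_of_lt_one (Real.exp_pos _).le hlt
    _ ≤ Real.exp (-l) ^ k / (l / 2) := by gcongr
    _ = _ := by field_simp

/-- For `q ≤ 1 / 15` the second exponential decays more slowly than the first. Giving up `1 / 24` of
its rate `3 / 8` absorbs `(t + 1) ^ 2` at the cost `q⁻⁴` and leaves rate `1 / 3`; the geometric
series costs a further `q⁻²`. -/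
lemma sum_absorbBound_le {q : ℝ} (hq0 : 0 < q) (hq1 : q ≤ 1 / 15) (k n : ℕ) :
    ∑ t ∈ Finset.Ico k n, 2 * absorbBound q t ≤
      55296 / q ^ 6 * Real.exp (-(q ^ 2 * k / 3)) := by
  have hq2 : q ^ 2 ≤ 1 / 225 := by nlinarith
  have hterm : ∀ t : ℕ, 2 * absorbBound q t ≤ 9216 / q ^ 4 * Real.exp (-(q ^ 2 / 3 * t)) := by
    intro t
    have ht0 : (0 : ℝ) ≤ t := Nat.cast_nonneg t
    have h1 : Real.exp (-(q * t / 40)) ≤ (t + 1) ^ 2 * Real.exp (-(3 / 8 * q ^ 2 * t)) := by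
      have h2 : Real.exp (-(q * t / 40)) ≤ Real.exp (-(3 / 8 * q ^ 2 * t)) := by
        apply Real.exp_le_exp.2
        have : 0 ≤ q * t * (1 / 15 - q) := mul_nonneg (by positivity) (by linarith)
        nlinarith
      have h3 : 1 ≤ ((t : ℝ) + 1) ^ 2 := one_le_pow₀ (by linarith)
      nlinarith [Real.exp_pos (-(3 / 8 * q ^ 2 * t))]
    have h4 : ((t : ℝ) + 1) ^ 2 ≤ 2304 / q ^ 4 * Real.exp (q ^ 2 * t / 24) := by
      have h5 := Real.quadratic_le_exp_of_nonneg
        (show (0 : ℝ) ≤ q ^ 2 * (t + 1) / 24 by positivity)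
      have h6 : Real.exp (q ^ 2 * (t + 1) / 24) ≤ 2 * Real.exp (q ^ 2 * t / 24) := by
        rw [show q ^ 2 * ((t : ℝ) + 1) / 24 = q ^ 2 / 24 + q ^ 2 * t / 24 by ring, Real.exp_add]
        gcongr
        have h7 : Real.exp (q ^ 2 / 24) ≤ Real.exp (1 / 2) := by
          apply Real.exp_le_exp.2; linarith
        have h8 := Real.exp_half (1 : ℝ)
        have h9 : Real.exp (1 / 2) ≤ 2 := by
          rw [h8, Real.sqrt_le_left (by norm_num)]
          linarith [Real.exp_one_lt_d9]
        linarith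
      have h10 : (q ^ 2 * (t + 1) / 24) ^ 2 / 2 ≤ 2 * Real.exp (q ^ 2 * t / 24) := by
        have : 0 ≤ q ^ 2 * ((t : ℝ) + 1) / 24 := by positivity
        linarith
      rw [div_mul_eq_mul_div, le_div_iff₀ (by positivity)]
      nlinarith
    calc 2 * absorbBound q t
        ≤ 2 * (2 * ((t + 1) ^ 2 * Real.exp (-(3 / 8 * q ^ 2 * t)))) := by
          unfold absorbBound
          linarith
      _ ≤ 2 * (2 * (2304 / q ^ 4 * Real.exp (q ^ 2 * t / 24) *
            Real.exp (-(3 / 8 * q ^ 2 * t)))) := by gcongr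
      _ = 9216 / q ^ 4 * (Real.exp (q ^ 2 * t / 24) * Real.exp (-(3 / 8 * q ^ 2 * t))) := by ring
      _ = _ := by
          rw [← Real.exp_add]
          ring_nf
  calc ∑ t ∈ Finset.Ico k n, 2 * absorbBound q t
      ≤ ∑ t ∈ Finset.Ico k n, 9216 / q ^ 4 * Real.exp (-(q ^ 2 / 3 * t)) :=
        Finset.sum_le_sum fun t _ => hterm t
    _ ≤ 9216 / q ^ 4 * (2 / (q ^ 2 / 3) * Real.exp (-(q ^ 2 / 3 * k))) := by
        rw [← Finset.mul_sum]
        gcongr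
        exact sum_exp_neg_mul_le (by positivity) (by linarith) k n
    _ = _ := by
        rw [show q ^ 2 / 3 * (k : ℝ) = q ^ 2 * k / 3 by ring]
        field_simp
        norm_num

lemma tendsto_log_div_sqrt_atTop :
    Tendsto (fun x : ℝ => Real.log x / √x) atTop (𝓝 0) := by
  have h := (isLittleO_log_rpow_atTop (show (0 : ℝ) < 1 / 2 by norm_num)).tendsto_div_nhds_zero
  simpa [Real.sqrt_eq_rpow] using h

/-- A bound for the probability of no saturation in terms of `l = log n` and `g = log log n`. -/
lemma openLaw_real_not_saturated_le_of_le {n : ℕ} {G : SimpleGraph (Fin n)} (hG : G.Connected)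
    {p : I} {l g : ℝ} (hl : l = Real.log n) (hg : g = Real.log l) (hn : 0 < n) (hl4 : 4 ≤ l)
    (hg2 : 2 ≤ g) (hq : g / √l ≤ 2 / 105) (hp : 4 * g / √l ≤ p) :
    (openLaw (edges G) p).real
      {Eopen | eventuallyOccupied (edges G) Eopen ≠ edges G ∪ Eopen} ≤
      Real.exp (-(Real.exp (1 / 8 * l) / l ^ 4)) + 55296 * Real.exp (-(g / 2)) := by
  have hl0 : 0 < l := by linarith
  have hsl : 0 < √l := Real.sqrt_pos.2 hl0
  have hsl2 : √l ^ 2 = l := Real.sq_sqrt hl0.le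
  have hnl : (n : ℝ) = Real.exp l := by rw [hl, Real.exp_log (by exact_mod_cast hn)]
  have hlg : l = Real.exp g := by rw [hg, Real.exp_log hl0]
  set y := g / √l with hy
  have hy0 : 0 < y := by positivity
  have hy2 : y ^ 2 = g ^ 2 / l := by rw [hy, div_pow, hsl2]
  -- Of the density `4 * y`, the part `7 / 2 * y` goes to growth and at least `y / 2 ≥ 1 / √l`
  -- remains for nucleation.
  set q' : ℝ := 7 / 2 * y with hq'
  have hq0 : 0 < q' := by positivity
  have hq15 : q' ≤ 1 / 15 := by rw [hq']; linarith
  have hp' : 4 * y ≤ p := by rw [hy, ← mul_div_assoc]; exact hp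
  have hp1 : (p : ℝ) ≤ 1 := p.2.2
  let q : I := ⟨q', hq0.le, by linarith⟩
  have h1q : 0 < 1 - q' := by linarith
  have hp₁ge : y / 2 ≤ (p - q') / (1 - q') := by
    rw [le_div_iff₀ h1q]
    nlinarith
  let p₁ : I := ⟨(p - q') / (1 - q'), by linarith, by rw [div_le_one h1q]; linarith⟩
  have hprod : (1 - p : ℝ) = (1 - p₁) * (1 - q) := by
    change (1 - p : ℝ) = (1 - (p - q') / (1 - q')) * (1 - q')
    field_simp
    ring
  -- A nucleus then succeeds with probability at least `l⁻ᵏ ≥ n ^ (-7 / 8) / l`, the last factor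
  -- being due to rounding up, against at least `n / l ^ 3` candidates.
  set k := ⌈7 / 8 * l / g⌉₊ with hk
  have hk1 : 7 / 8 * l / g ≤ k := Nat.le_ceil _
  have hk2 : (k : ℝ) ≤ 7 / 8 * l / g + 1 := (Nat.ceil_lt_add_one (by positivity)).le
  have hk3 : (k : ℝ) + 1 ≤ l := by
    have : 7 / 8 * l / g ≤ 7 / 8 * l / 2 := by gcongr
    linarith
  have hln : l ≤ n := by rw [hnl]; linarith [Real.add_one_le_exp l]
  have hkn : k + 1 ≤ Fintype.card (Fin n) := by
    rw [Fintype.card_fin]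
    exact_mod_cast hk3.trans hln
  refine (openLaw_real_not_saturated_le hG hprod hkn).trans (add_le_add ?_ ?_)
  · apply Real.exp_le_exp.2
    rw [Fintype.card_fin]
    have h1 : Real.exp (-(7 / 8 * l + g)) ≤ (p₁ : ℝ) ^ (2 * k) := by
      have h2 : 1 / √l ≤ (p₁ : ℝ) := by
        refine le_trans ?_ hp₁ge
        rw [hy, div_div, div_le_div_iff₀ hsl (by positivity)]
        nlinarith
      calc Real.exp (-(7 / 8 * l + g)) ≤ Real.exp (-(g * k)) := by
            apply Real.exp_le_exp.2
            have : g * k ≤ g * (7 / 8 * l / g + 1) := by gcongr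
            have h3 : g * (7 / 8 * l / g + 1) = 7 / 8 * l + g := by field_simp
            linarith
        _ = (1 / √l) ^ (2 * k) := by
            rw [pow_mul, div_pow, hsl2, hlg, one_pow, one_div, ← Real.exp_neg, ← Real.exp_nat_mul]
            ring_nf
        _ ≤ _ := by gcongr
    have h2 : (n : ℝ) / l ^ 3 ≤ n / ((k + 1) * (1 + k * (k + 1))) := by
      have hk0 : (0 : ℝ) ≤ k := Nat.cast_nonneg k
      have hk4 : (k : ℝ) ≤ l - 1 := by linarith
      gcongr
      calc ((k : ℝ) + 1) * (1 + k * (k + 1)) ≤ l * (1 + (l - 1) * l) := by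
            gcongr
            linarith
        _ ≤ l ^ 3 := by nlinarith
    rw [neg_le_neg_iff]
    calc Real.exp (1 / 8 * l) / l ^ 4
        = Real.exp (-(7 / 8 * l + g)) * (n / l ^ 3) := by
          have h3 : Real.exp (-(7 / 8 * l + g)) = Real.exp (1 / 8 * l) / (n * l) := by
            rw [hnl]
            nth_rw 4 [hlg]
            rw [← Real.exp_add, ← Real.exp_sub]
            ring_nf
          rw [h3]
          have : (n : ℝ) ≠ 0 := by positivity
          field_simp
      _ ≤ _ := mul_le_mul h1 h2 (by positivity) (pow_nonneg p₁.2.1 _)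
  · refine (sum_absorbBound_le hq0 hq15 _ _).trans ?_
    have hq2 : q' ^ 2 = 49 / 4 * (g ^ 2 / l) := by rw [hq', mul_pow, hy2]; norm_num
    -- The exponent is at least `343 / 96 * g`. It must exceed `3 * g`, since `q' ^ (-6)` can be as
    -- large as `l ^ 3 = exp (3 * g)` in the bound used; `exp (-g / 2)` is left.
    have h1 : 7 / 2 * g ≤ q' ^ 2 * k / 3 := by
      have h2 : 49 / 4 * (g ^ 2 / l) * (7 / 8 * l / g) ≤ q' ^ 2 * k := by
        rw [hq2]; gcongr
      have h3 : 49 / 4 * (g ^ 2 / l) * (7 / 8 * l / g) = 343 / 32 * g := by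
        field_simp
        ring
      linarith
    have h4 : 55296 / q' ^ 6 ≤ 55296 * Real.exp (3 * g) := by
      have h5 : 1 / l ≤ q' ^ 2 := by
        rw [hq2, ← mul_div_assoc]
        gcongr
        nlinarith
      have h6 : (1 / l) ^ 3 ≤ q' ^ 6 := by
        rw [show q' ^ 6 = (q' ^ 2) ^ 3 by ring]
        gcongr
      have h7 : Real.exp (3 * g) = l ^ 3 := by
        rw [hlg, ← Real.exp_nat_mul]; norm_num
      rw [h7, div_le_iff₀ (by positivity)]
      have h8 : l ^ 3 * (1 / l) ^ 3 = 1 := by field_simp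
      have h9 : l ^ 3 * (1 / l) ^ 3 ≤ l ^ 3 * q' ^ 6 := by gcongr
      linarith
    calc 55296 / q' ^ 6 * Real.exp (-(q' ^ 2 * k / 3))
        ≤ 55296 * Real.exp (3 * g) * Real.exp (-(7 / 2 * g)) := by
          gcongr
      _ = _ := by
          rw [mul_assoc, ← Real.exp_add]
          ring_nf

theorem tendsto_probSaturated {C : ℝ} (hC : 4 < C) (G : (n : ℕ) → SimpleGraph (Fin n))
    (p : ℕ → I) (hG : ∀ᶠ n in atTop, (G n).Connected)
    (hp : ∀ᶠ n : ℕ in atTop, C * Real.log (Real.log n) / √(Real.log n) ≤ (p n : ℝ)) :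
    Tendsto (fun n : ℕ => probSaturated (edges (G n)) (p n)) atTop (𝓝 1) := by
  have hl := tendsto_log_natCast_atTop
  have hg := Real.tendsto_log_atTop.comp hl
  have hlim1 : Tendsto (fun l : ℝ => Real.exp (-(Real.exp (1 / 8 * l) / l ^ 4))) atTop (𝓝 0) := by
    have h := tendsto_exp_mul_div_rpow_atTop 4 (1 / 8) (by norm_num)
    refine Real.tendsto_exp_neg_atTop_nhds_zero.comp ?_
    refine h.congr fun x => ?_
    norm_cast
  have hlim2 : Tendsto (fun g : ℝ => 55296 * Real.exp (-(g / 2))) atTop (𝓝 0) := by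
    have h := (Real.tendsto_exp_neg_atTop_nhds_zero.comp
      (tendsto_id.atTop_div_const (show (0 : ℝ) < 2 by norm_num))).const_mul 55296
    simpa using h
  have hlim := (hlim1.comp hl).add (hlim2.comp hg)
  rw [add_zero] at hlim
  have hlim' := ENNReal.Tendsto.sub (tendsto_const_nhds (x := (1 : ℝ≥0∞)))
    (ENNReal.tendsto_ofReal hlim) (by simp)
  rw [ENNReal.ofReal_zero, tsub_zero] at hlim'
  refine tendsto_of_tendsto_of_tendsto_of_le_of_le' hlim' tendsto_const_nhds ?_
    (Eventually.of_forall fun n => prob_le_one)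
  filter_upwards [hG, hp, hl.eventually_ge_atTop 4, hg.eventually_ge_atTop 2,
    (tendsto_log_div_sqrt_atTop.comp hl).eventually_le_const (show (0 : ℝ) < 2 / 105 by norm_num),
    eventually_gt_atTop 0] with n hGn hpn hl4 hg2 hq hn
  simp only [Function.comp_apply] at hg2 hq ⊢
  have hpn' : 4 * Real.log (Real.log n) / √(Real.log n) ≤ p n := by
    refine le_trans ?_ hpn
    gcongr
  have h := openLaw_real_not_saturated_le_of_le hGn rfl rfl hn hl4 hg2 hq hpn'
  have h' : openLaw (edges (G n)) (p n)
      {Eopen | eventuallyOccupied (edges (G n)) Eopen = edges (G n) ∪ Eopen}ᶜ ≤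
      ENNReal.ofReal _ :=
    (ENNReal.le_ofReal_iff_toReal_le (measure_ne_top _ _) (by positivity)).2 h
  rw [probSaturated, ← compl_compl {Eopen | eventuallyOccupied (edges (G n)) Eopen =
    edges (G n) ∪ Eopen}, prob_compl_eq_one_sub MeasurableSet.of_discrete]
  exact tsub_le_tsub_left h' 1

end TransClosure

open TransClosure in
theorem theorem1 :
    -- the basic theorem: connected unoriented initial graphs of bounded degree
    (∀ (D : ℕ) (α : ℝ), 0 < α → ∃ c C : ℝ, 0 < c ∧ 0 < C ∧
      ∀ (G : (n : ℕ) → SimpleGraph (Fin n)) (p : ℕ → I),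
        (∀ᶠ n in atTop, (G n).Connected ∧ ∀ v, ((G n).neighborSet v).ncard ≤ D) →
        ((∀ᶠ n : ℕ in atTop, (p n : ℝ) < c * (1 / √(Real.log n))) →
          Tendsto (fun n : ℕ => openLaw (edges (G n)) (p n)
              {Eopen | ¬ ∃ e ∈ eventuallyOccupied (edges (G n)) Eopen,
                ENNReal.ofReal (α * Real.log n) < (length (edges (G n)) e : ℝ≥0∞)})
            atTop (𝓝 1)) ∧
        ((∀ᶠ n : ℕ in atTop, C * (Real.log (Real.log n) / √(Real.log n)) < (p n : ℝ)) →
          Tendsto (fun n : ℕ => probSaturated (edges (G n)) (p n)) atTop (𝓝 1))) ∧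
    -- stronger form of the first part: oriented initial graphs of bounded in- and out-degree
    (∀ (D : ℕ) (α : ℝ), 0 < α → ∃ c : ℝ, 0 < c ∧
      ∀ (E0 : (n : ℕ) → Set (Fin n × Fin n)) (p : ℕ → I),
        (∀ᶠ n in atTop, ∀ v, (v, v) ∉ E0 n ∧
          {w | (v, w) ∈ E0 n}.ncard ≤ D ∧ {w | (w, v) ∈ E0 n}.ncard ≤ D) →
        (∀ᶠ n : ℕ in atTop, (p n : ℝ) < c / √(Real.log n)) →
        Tendsto (fun n : ℕ => openLaw (E0 n) (p n)
            {Eopen | ∃ e ∈ eventuallyOccupied (E0 n) Eopen,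
              ENNReal.ofReal (α * Real.log n) ≤ (length (E0 n) e : ℝ≥0∞)})
          atTop (𝓝 0)) ∧
    -- stronger form of the second part: any connected unoriented initial graph, any `C > 4`
    (∀ C : ℝ, 4 < C → ∀ (G : (n : ℕ) → SimpleGraph (Fin n)) (p : ℕ → I),
        (∀ᶠ n in atTop, (G n).Connected) →
        (∀ᶠ n : ℕ in atTop, C * Real.log (Real.log n) / √(Real.log n) ≤ (p n : ℝ)) →
        Tendsto (fun n : ℕ => probSaturated (edges (G n)) (p n)) atTop (𝓝 1)) := by
  refine ⟨fun D α hα => ?_, exists_tendsto_long, fun C hC G p => tendsto_probSaturated hC G p⟩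
  obtain ⟨c, hc, h⟩ := exists_tendsto_not_long D α hα
  refine ⟨c, 5, hc, by norm_num, fun G p hG => ⟨h G p (hG.mono fun n hn => hn.2), fun hp => ?_⟩⟩
  refine tendsto_probSaturated (show (4 : ℝ) < 5 by norm_num) G p (hG.mono fun n hn => hn.1) ?_
  filter_upwards [hp] with n hn
  rw [mul_div_assoc]
  exact hn.le
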